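/- Let $p\ge 2$ be an integer (not necessarily prime), let $m\ge 0$ and $k\ge 1$ be integers, and for $x\in\mathbb Z$ let $\operatorname{ord}_p(x)=\max\{L\ge 0: p^L\mid x\}$ if $x\ne0$ and $\operatorname{ord}_p(0)=\infty$. *The game.* Let $\mathcal W^m_{p,k}$ be the game whose positions are the $m$-element subsets of $\mathbb N=\{0,1,2,\dots\}$ and in which there is a move from $X$ to $Y$ (and $Y$ is called an option of $X$) if and only if there are enumerations $X=\{x^1,\dots,x^m\}$, $Y=\{y^1,\dots,y^m\}$ with (1) $0<\#\{i: x^i\ne y^i\}<k$, (2) $y^i\le x^i$ for all $i$, and (3) $\operatorname{ord}_p\bigl(\sum_i (x^i-y^i)\bigr)=\min_i \operatorname{ord}_p(x^i-y^i)$. The Sprague–Grundy number $\operatorname{sg}(X)$ is the least $n\in\mathbb N$ such that no option $Y$ of $X$ has $\operatorname{sg}(Y)=n$. A descendant of $X$ is a position that can be reached from $X$ by finitely many (possibly zero) moves. The game $\mathcal W^m_{p,k}$ is called a $p$-saturation of Welter's game (with $m$ coins) if it has the same Sprague–Grundy function as $\mathcal W^m_{p,m+1}$. *Partitions and hooks.*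 For a finite set $X=\{x_1>x_2>\dots>x_m\}\subset\mathbb N$ let $\lambda(X)$ be the partition $(x_1-m+1,\,x_2-m+2,\,\dots,\,x_m)$, identified with its Young diagram, and let $|\lambda(X)|$ be its size. The hook at a cell $(i,j)\in\lambda(X)$ consists of the cells $(i',j')\in\lambda(X)$ with $i'\ge i,\ j'=j$ or $i'=i,\ j'\ge j$, and its length is the number of its cells. For $L\ge0$ let $b_L(X)\in\{0,\dots,p-1\}$ be the remainder modulo $p$ of the number of hooks of $\lambda(X)$ whose length is a multiple of $p^L$. *The $p$-core tower.* For $0\le R<p^L$ let $X_R=\{\lfloor x/p^L\rfloor : x\in X,\ x\equiv R \pmod {p^L}\}$. The $p$-core of a finite set $Z\subset\mathbb N$ is $Z_{(p)}=\{r+pt : 0\le r<p,\ 0\le t<\#\{z\in Z: z\equiv r \pmod p\}\}$. Put $$\omega_L(X)=\sum_{0\le R<p^L}\bigl|\lambda\bigl((X_R)_{(p)}\bigr)\bigr| .$$ **Proposition.** Let $X$ be a position in a $p$-saturation $\mathcal W^m_{p,k}$ of Welter's game, and suppose that $\omega_N(X)\ge p+1$ for some $N\ge0$. Then the maximum $$\operatorname{msg}(X)=\max\{\operatorname{sg}(Y)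 : Y \text{ is a descendant of } X \text{ with } \operatorname{sg}(Y)=|\lambda(Y)|\}$$ exists and satisfies $$\operatorname{msg}(X)\ \ge\ \sum_{L=0}^{N}(p-1)\,p^L+\sum_{L\ge N+1} b_L(X)\,p^L ,$$ that is, $\operatorname{msg}(X)\ge(p-1,\dots,p-1,\,b_{N+1}(X),\,b_{N+2}(X),\dots)_p$ with $N+1$ leading entries $p-1$ (base-$p$ digits, least significant first). -/

import Mathlib

/-! ### Impartial games and Sprague-Grundy numbers -/

/-- An impartial game: a directed graph on `V` in which the lengths of the paths from each vertex
are bounded. (The bound is expressed by a function that drops along every edge; the maximum length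
of a path from a vertex is the least such function.) -/
structure ImpartialGame (V : Type*) where
  /-- `Edge X Y`: there is an edge from `X` to `Y`, i.e. `Y` is an option of `X`. -/
  Edge : V → V → Prop
  exists_rank : ∃ ℓ : V → ℕ, ∀ X Y, Edge X Y → ℓ Y < ℓ X

namespace ImpartialGame

variable {V : Type*}

theorem wellFounded (G : ImpartialGame V) : WellFounded (fun Y X => G.Edge X Y) := by
  obtain ⟨l, hl⟩ := G.exists_rank
  exact Subrelation.wf (fun {Y X} h => hl X Y h) (measure l).wf

/-- The Sprague-Grundy number: the least `n` such that no option `Y` of `X` has number `n`. -/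
noncomputable def sg (G : ImpartialGame V) : V → ℕ :=
  G.wellFounded.fix fun X rec => sInf {n : ℕ | ∀ (Y : V) (h : G.Edge X Y), rec Y h ≠ n}

theorem sg_eq (G : ImpartialGame V) (X : V) :
    G.sg X = sInf {n : ℕ | ∀ Y : V, G.Edge X Y → G.sg Y ≠ n} := by
  unfold sg
  rw [WellFounded.fix_eq]

/-- `Y` is a descendant of `X`: there is a path (possibly of length zero) from `X` to `Y`. -/
def IsDescendant (G : ImpartialGame V) (X Y : V) : Prop :=
  Relation.ReflTransGen G.Edge X Y

end ImpartialGame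

/-! ### Welter's game with `p`-index `k` -/

namespace Welter

/-- The positions of Welter's game with `m` coins (set representation). -/
abbrev Position (m : ℕ) : Type := {X : Finset ℕ // X.card = m}

/-- The moves of Welter's game with `p`-index `k`, in the tuple representation. Here
`emultiplicity p a` is the `p`-adic order of `a`, which is `⊤` for `a = 0`. -/
def IsTupleMove (p k : ℕ) {m : ℕ} (x y : Fin m → ℕ) : Prop :=
  (0 < hammingDist x y ∧ hammingDist x y < k) ∧
  (∀ i, y i ≤ x i) ∧
  emultiplicity (p : ℤ) (∑ i, ((x i : ℤ) - (y i : ℤ))) =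
    ⨅ i, emultiplicity (p : ℤ) ((x i : ℤ) - (y i : ℤ))

/-- The moves in the set representation: there is a move between suitable enumerations of the
two sets. -/
def IsMove (p k : ℕ) {m : ℕ} (X Y : Position m) : Prop :=
  ∃ x y : Fin m → ℕ,
    Finset.univ.image x = X.1 ∧ Finset.univ.image y = Y.1 ∧ IsTupleMove p k x y

theorem sum_eq_of_image_eq {m : ℕ} (X : Position m) (x : Fin m → ℕ)
    (h : Finset.univ.image x = X.1) : ∑ a ∈ X.1, a = ∑ i, x i := by
  have hinj : Set.InjOn x (Finset.univ : Finset (Fin m)) := by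
    apply Finset.card_image_iff.mp
    rw [h, X.2, Finset.card_univ, Fintype.card_fin]
  rw [← h, Finset.sum_image hinj]

/-- Welter's game with `m` coins and `p`-index `k`. -/
def game (p m k : ℕ) : ImpartialGame (Position m) where
  Edge := IsMove p k
  exists_rank := by
    refine ⟨fun X => ∑ a ∈ X.1, a, ?_⟩
    rintro X Y ⟨x, y, hx, hy, ⟨hd, -⟩, hle, -⟩
    simp only [sum_eq_of_image_eq X x hx, sum_eq_of_image_eq Y y hy]
    have hne : x ≠ y := hammingDist_pos.mp hd
    obtain ⟨i, hi⟩ := Function.ne_iff.mp hne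
    exact Finset.sum_lt_sum (fun j _ => hle j)
      ⟨i, Finset.mem_univ i, lt_of_le_of_ne (hle i) (Ne.symm hi)⟩

/-- The game with `m` coins and `p`-index `k` is a `p`-saturation of Welter's game with `m` coins:
`k` is positive, and the game has the same Sprague-Grundy function as the one with `p`-index
`m + 1`. -/
def IsSaturation (p m k : ℕ) : Prop :=
  0 < k ∧ (game p m k).sg = (game p m (m + 1)).sg

/-! ### The partition of a position, and its hooks -/

/-- The coins of `X` in decreasing order, `coin X 0 > coin X 1 > ⋯`. -/
def coin (X : Finset ℕ) (i : Fin X.card) : ℕ :=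
  X.orderEmbOfFin rfl i.rev

/-- The `i`th part `coin X i - (m - 1 - i)` of the partition of `X`, where `m = X.card` and `i` is
counted from zero. (The subtractions never truncate, since `m - 1 - i` coins lie below
`coin X i`.) -/
def part (X : Finset ℕ) (i : Fin X.card) : ℕ :=
  coin X i - (X.card - 1 - i)

theorem part_antitone (X : Finset ℕ) : Antitone (part X) := by
  have key : ∀ n : ℕ, ∀ i j : Fin X.card, (j : ℕ) = i + n → coin X j + n ≤ coin X i := by
    intro n
    induction n with
    | zero =>
      intro i j h
      have : j = i := Fin.ext (by simpa using h)
      simp [this]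
    | succ n ih =>
      intro i j h
      have hj := j.2
      have h1 := ih i ⟨i + n, by omega⟩ rfl
      have h2 : coin X j < coin X ⟨i + n, by omega⟩ := by
        unfold coin
        apply (X.orderEmbOfFin rfl).strictMono
        rw [Fin.rev_lt_rev, Fin.lt_def]
        simp only
        omega
      omega
  intro i j hij
  have hij' : (i : ℕ) ≤ j := hij
  have h := key (j - i) i j (by omega)
  have hj := j.2
  unfold part
  omega

/-- The Young diagram of the partition `λ(X)`; rows and columns are counted from zero. -/
def diagram (X : Finset ℕ) : YoungDiagram where
  cells := Finset.univ.biUnion fun i : Fin X.card =>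
    (Finset.range (part X i)).image fun j => ((i : ℕ), j)
  isLowerSet := by
    rintro ⟨a, b⟩ ⟨c, d⟩ ⟨hca, hdb⟩ h
    simp only [Finset.coe_biUnion, Finset.coe_univ, Set.mem_univ, Set.iUnion_true, Set.mem_iUnion,
      Finset.coe_image, Set.mem_image, Finset.coe_range, Set.mem_Iio, Prod.mk.injEq] at h ⊢
    obtain ⟨i, j, hj, hi, rfl⟩ := h
    simp only at hca hdb
    have hc : c < X.card := lt_of_le_of_lt (hca.trans hi.ge) i.2
    have hle : (⟨c, hc⟩ : Fin X.card) ≤ i := by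
      rw [Fin.le_def]
      simp only
      omega
    exact ⟨⟨c, hc⟩, d, lt_of_le_of_lt hdb (lt_of_lt_of_le hj (part_antitone X hle)), rfl, rfl⟩

/-- The size of `λ(X)`. -/
def size (X : Finset ℕ) : ℕ := (diagram X).card

/-- The hook of a Young diagram at the cell `c`. -/
def hook (D : YoungDiagram) (c : ℕ × ℕ) : Finset (ℕ × ℕ) :=
  D.cells.filter fun d => (c.1 ≤ d.1 ∧ d.2 = c.2) ∨ (d.1 = c.1 ∧ c.2 ≤ d.2)

/-- The number of `p ^ L`-hooks of `λ(X)`, i.e. of hooks whose length is a multiple of `p ^ L`. -/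
def hookCount (p : ℕ) (X : Finset ℕ) (L : ℕ) : ℕ :=
  ((diagram X).cells.filter fun c => p ^ L ∣ (hook (diagram X) c).card).card

/-- `b_L(X)`: the remainder modulo `p` of the number of `p ^ L`-hooks of `λ(X)`. -/
def hookDigit (p : ℕ) (X : Finset ℕ) (L : ℕ) : ℕ := hookCount p X L % p

theorem hookDigit_eq_zero (p : ℕ) (hp : 2 ≤ p) (X : Finset ℕ) (L : ℕ) (hL : size X ≤ L) :
    hookDigit p X L = 0 := by
  have h0 : hookCount p X L = 0 := by
    unfold hookCount
    rw [Finset.card_eq_zero, Finset.filter_eq_empty_iff]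
    intro c hc hdvd
    have hpos : 0 < (hook (diagram X) c).card :=
      Finset.card_pos.mpr ⟨c, by simp [hook] at hc ⊢; exact hc⟩
    have h1 : (hook (diagram X) c).card ≤ size X :=
      Finset.card_le_card (Finset.filter_subset _ _)
    have h2 := Nat.le_of_dvd hpos hdvd
    have h3 : L < p ^ L := Nat.lt_pow_self (by omega)
    omega
  simp [hookDigit, h0]

/-! ### The `p`-core tower -/

/-- `X_R` for a residue `R` modulo `p ^ L`: the quotients by `p ^ L` of the elements of `X` that
are congruent to `R`. A sequence of `L` digits in base `p` is identified with the number
`R < p ^ L` that it represents (least significant digit first). -/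
def component (p L : ℕ) (X : Finset ℕ) (R : ℕ) : Finset ℕ :=
  (X.filter fun x => x % p ^ L = R).image fun x => x / p ^ L

/-- The `p`-core of `X`: the set whose component at each residue `r` modulo `p` is
`{0, 1, …, |X_r| - 1}`. -/
def core (p : ℕ) (X : Finset ℕ) : Finset ℕ :=
  (Finset.range p).biUnion fun r =>
    (Finset.range (component p 1 X r).card).image fun t => r + p * t

/-- `ω_L(X)`: the sum of the sizes of the partitions in the `L`th row of the `p`-core tower. -/
def tower (p : ℕ) (X : Finset ℕ) (L : ℕ) : ℕ :=
  ∑ R ∈ Finset.range (p ^ L), size (core p (component p L X R))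

/-! ### The quantity to be bounded -/

/-- The Sprague-Grundy numbers of the descendants `Y` of `X` with `sg Y = |λ(Y)|`. -/
def fullValues (p m k : ℕ) (X : Position m) : Set ℕ :=
  {n | ∃ Y : Position m, (game p m k).IsDescendant X Y ∧
    (game p m k).sg Y = size Y.1 ∧ n = (game p m k).sg Y}

/-- `msg(X)`, the maximum of `fullValues`. -/
noncomputable def msg (p m k : ℕ) (X : Position m) : ℕ := sSup (fullValues p m k X)

/-- The number with base-`p` digits `a 0, a 1, …` (least significant first), for `a` finitely
supported. -/
noncomputable def ofDigitSeq (p : ℕ) (a : ℕ → ℕ) : ℕ := ∑ᶠ L, a L * p ^ L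

end Welter

/-! A position is a set of beads on an abacus. `weight q X` counts pairs of a bead and a lower gap
at a distance divisible by `q`; these pairs are the hooks of length divisible by `q`, so `weight 1
X` is the size of the diagram. `Dom Y X` means that the diagram of `Y` lies inside that of `X`. A
Sprague–Grundy number never exceeds the size, and for `k ≥ 2` boxes can be removed one at a time by
legal moves, so every contained diagram is a descendant. It therefore suffices to find inside the
diagram of `X` a large diagram whose Sprague–Grundy number equals its size.

The `Full` diagrams have this property. Given a full diagram of size `n` and `s < n`, write `n - s =
p ^ M * j` with `p ∤ j`. Beads can be lowered by multiples of `p ^ M`, by `p ^ M * j` in total, so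
that the result is full again (`Full.exists_lowering`). This is a legal move for index `m + 1`, so
induction gives `Full.sg_eq_weight`; saturation carries it over to index `k`.

Two tools produce full diagrams. By `exists_qcore_eq_weight_eq`, removing boxes can shrink the
`q`-core to any `q`-core inside it while the `q`-weight is kept; iterated along `q`, `q * p`, `q * p
^ 2`, … this controls the rows of the core tower modulo `p` (`exists_qcore_eq_layer`). By
`exists_box_removal`, if the `p ^ H`-core is empty and `p` does not divide the `p ^ H`-weight, then
some corner has content prime to divisibility by `p`, and its removal gives every `p ^ L`-core with
`L ≤ H` the size `p ^ L - 1`.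

The hypothesis on row `N` puts a diagram with empty `p ^ N`-core and `p ^ N`-weight `p + 1` inside
the `p ^ (N + 1)`-core of `X`. Removing one good box and then one `p ^ N`-hook leaves size `p ^ (N +
1) - 1`. The rows above `N` are cut down below `p` without losing the required value
(`exists_layer_lt`), and the small diagram is installed as the new `p ^ (N + 1)`-core
(`exists_full`). -/

namespace Abacus
open Finset

/-! ### Runners and cores -/

/-- The `r`th runner of the abacus of `X` with `q` runners. -/
def runner (q r : ℕ) (X : Finset ℕ) : Finset ℕ :=
  (X.filter fun x => x % q = r).image fun x => x / q

/-- The `q`-core of `X`: all beads are pushed down on their runners. -/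
def qcore (q : ℕ) (X : Finset ℕ) : Finset ℕ :=
  (range q).biUnion fun r => (range (runner q r X).card).image fun t => r + q * t

/-- The number of pairs of a bead and a lower gap at a distance divisible by `q`. -/
def weight (q : ℕ) (X : Finset ℕ) : ℕ :=
  ∑ x ∈ X, #{y ∈ range x | y ∉ X ∧ q ∣ x - y}

theorem add_mul_div_of_lt {q r t : ℕ} (hr : r < q) : (r + q * t) / q = t := by
  rw [Nat.add_mul_div_left _ _ (by omega), Nat.div_eq_of_lt hr, zero_add]

theorem add_mul_mod_of_lt {q r t : ℕ} (hr : r < q) : (r + q * t) % q = r := by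
  rw [Nat.add_mul_mod_self_left, Nat.mod_eq_of_lt hr]

theorem mem_runner {q r t : ℕ} {X : Finset ℕ} (hr : r < q) :
    t ∈ runner q r X ↔ r + q * t ∈ X := by
  simp only [runner, mem_image, mem_filter]
  constructor
  · rintro ⟨x, ⟨hx, rfl⟩, rfl⟩
    rwa [Nat.mod_add_div]
  · intro h
    exact ⟨_, ⟨h, add_mul_mod_of_lt hr⟩, add_mul_div_of_lt hr⟩

theorem div_mem_runner {q x : ℕ} {X : Finset ℕ} (hq : 0 < q) :
    x / q ∈ runner q (x % q) X ↔ x ∈ X := by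
  rw [mem_runner (Nat.mod_lt _ hq), Nat.mod_add_div]

theorem runner_one (X : Finset ℕ) : runner 1 0 X = X := by
  ext t; rw [mem_runner one_pos]; simp

theorem eq_of_runner_eq {q : ℕ} (hq : 0 < q) {X Y : Finset ℕ}
    (h : ∀ r < q, runner q r X = runner q r Y) : X = Y := by
  ext x
  rw [← div_mem_runner hq, h _ (Nat.mod_lt _ hq), div_mem_runner hq]

theorem sum_runner {M : Type*} [AddCommMonoid M] {q : ℕ} (hq : 0 < q) (X : Finset ℕ) (g : ℕ → M) :
    ∑ x ∈ X, g x = ∑ r ∈ range q, ∑ t ∈ runner q r X, g (r + q * t) := by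
  rw [← sum_fiberwise_of_maps_to (g := fun x => x % q) (t := range q)
    (fun x _ => mem_range.mpr (Nat.mod_lt _ hq))]
  refine sum_congr rfl fun r hr => ?_
  rw [mem_range] at hr
  unfold runner
  rw [sum_image]
  · refine sum_congr rfl fun x hx => ?_
    rw [← (mem_filter.mp hx).2, Nat.mod_add_div]
  · intro x hx y hy hxy
    simp only [coe_filter, Set.mem_ofPred_eq] at hx hy
    rw [← Nat.mod_add_div x q, ← Nat.mod_add_div y q, hx.2, hy.2]
    simp only at hxy
    rw [hxy]

theorem card_runner (q r : ℕ) (X : Finset ℕ) :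
    (runner q r X).card = #{x ∈ X | x % q = r} := by
  unfold runner
  apply card_image_of_injOn
  intro x hx y hy hxy
  simp only [coe_filter, Set.mem_ofPred_eq] at hx hy
  rw [← Nat.mod_add_div x q, ← Nat.mod_add_div y q, hx.2, hy.2]
  simp only at hxy
  rw [hxy]

theorem sum_card_runner {q : ℕ} (hq : 0 < q) (X : Finset ℕ) :
    ∑ r ∈ range q, (runner q r X).card = X.card := by
  rw [card_eq_sum_ones X, sum_runner hq X]
  simp

theorem runner_runner {q s r i : ℕ} (hr : r < q) (hi : i < s) (X : Finset ℕ) :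
    runner s i (runner q r X) = runner (q * s) (r + q * i) X := by
  have hlt : r + q * i < q * s := by nlinarith
  ext t
  rw [mem_runner hi, mem_runner hr, mem_runner hlt]
  ring_nf

theorem mem_qcore {q x : ℕ} (hq : 0 < q) {X : Finset ℕ} :
    x ∈ qcore q X ↔ x / q < (runner q (x % q) X).card := by
  simp only [qcore, mem_biUnion, mem_image, mem_range]
  constructor
  · rintro ⟨r, hr, t, ht, rfl⟩
    rwa [add_mul_mod_of_lt hr, add_mul_div_of_lt hr]
  · intro h
    exact ⟨x % q, Nat.mod_lt _ hq, x / q, h, Nat.mod_add_div _ _⟩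

theorem runner_qcore {q r : ℕ} (hr : r < q) (X : Finset ℕ) :
    runner q r (qcore q X) = range (runner q r X).card := by
  ext t
  rw [mem_runner hr, mem_qcore (by omega), add_mul_mod_of_lt hr, add_mul_div_of_lt hr, mem_range]

theorem card_qcore {q : ℕ} (hq : 0 < q) (X : Finset ℕ) : (qcore q X).card = X.card := by
  rw [← sum_card_runner hq, ← sum_card_runner hq X]
  refine sum_congr rfl fun r hr => ?_
  rw [runner_qcore (mem_range.mp hr), card_range]

theorem qcore_congr {q : ℕ} (hq : 0 < q) {X Y : Finset ℕ}
    (h : ∀ r < q, (runner q r X).card = (runner q r Y).card) : qcore q X = qcore q Y := by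
  ext x
  rw [mem_qcore hq, mem_qcore hq, h _ (Nat.mod_lt _ hq)]

theorem runner_qcore_mul {q s r : ℕ} (hs : 0 < s) (hr : r < q) (X : Finset ℕ) :
    runner q r (qcore (q * s) X) = qcore s (runner q r X) := by
  have hq : 0 < q := by omega
  refine eq_of_runner_eq hs fun i hi => ?_
  have hlt : r + q * i < q * s := by nlinarith
  rw [runner_runner hr hi, runner_qcore hlt, runner_qcore hi, runner_runner hr hi]

theorem qcore_qcore_mul {q s : ℕ} (hq : 0 < q) (hs : 0 < s) (X : Finset ℕ) :
    qcore q (qcore (q * s) X) = qcore q X := by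
  refine qcore_congr hq fun r hr => ?_
  rw [runner_qcore_mul hs hr, card_qcore hs]

theorem qcore_idem {q : ℕ} (hq : 0 < q) (X : Finset ℕ) : qcore q (qcore q X) = qcore q X := by
  simpa using qcore_qcore_mul hq one_pos X

theorem qcore_eq_of_dvd {q q' : ℕ} (hq' : 0 < q') (h : q ∣ q') {X Y : Finset ℕ}
    (hXY : qcore q' X = qcore q' Y) : qcore q X = qcore q Y := by
  obtain ⟨s, rfl⟩ := h
  have hq : 0 < q := Nat.pos_of_mul_pos_right hq'
  have hs : 0 < s := Nat.pos_of_mul_pos_left hq'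
  rw [← qcore_qcore_mul hq hs X, hXY, qcore_qcore_mul hq hs]

theorem eq_range_of_down_closed {Z : Finset ℕ} (h : ∀ t, t + 1 ∈ Z → t ∈ Z) :
    Z = range Z.card := by
  have h' : ∀ t ∈ Z, ∀ u ≤ t, u ∈ Z := by
    intro t ht u hu
    obtain ⟨d, rfl⟩ := Nat.exists_eq_add_of_le hu
    induction d with
    | zero => exact ht
    | succ d ih => exact ih (h _ ht) (by omega)
  refine eq_of_subset_of_card_le (fun t ht => ?_) (by simp)
  have : range (t + 1) ⊆ Z := fun u hu => h' t ht u (by simp at hu; omega)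
  have := card_le_card this
  simp at this ⊢
  omega

theorem qcore_eq_self {q : ℕ} (hq : 0 < q) {X : Finset ℕ}
    (h : ∀ x ∈ X, q ≤ x → x - q ∈ X) : qcore q X = X := by
  refine eq_of_runner_eq hq fun r hr => ?_
  rw [runner_qcore hr, ← eq_range_of_down_closed]
  intro t ht
  rw [mem_runner hr] at ht ⊢
  have := h _ ht (by nlinarith)
  have e : r + q * (t + 1) - q = r + q * t := by rw [mul_add, mul_one]; omega
  rwa [e] at this

theorem sub_mem_of_qcore_eq {q : ℕ} (hq : 0 < q) {X : Finset ℕ} (h : qcore q X = X) {x : ℕ}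
    (hx : x ∈ X) (y : ℕ) (hy : y ≤ x) (hxy : q ∣ x - y) : y ∈ X := by
  rw [← h, mem_qcore hq] at hx ⊢
  obtain ⟨k, hk⟩ := hxy
  obtain rfl : x = y + q * k := by omega
  rw [Nat.add_mul_div_left _ _ hq, Nat.add_mul_mod_self_left] at hx
  omega

/-! ### Hook weights -/

theorem weight_runner {q s : ℕ} (hq : 0 < q) (X : Finset ℕ) :
    weight (q * s) X = ∑ r ∈ range q, weight s (runner q r X) := by
  unfold weight
  rw [sum_runner hq]
  refine sum_congr rfl fun r hr => sum_congr rfl fun t ht => ?_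
  rw [mem_range] at hr
  symm
  apply card_bij (fun u _ => r + q * u)
  · intro u hu
    simp only [mem_filter, mem_range] at hu ⊢
    obtain ⟨h1, h2, h3⟩ := hu
    rw [mem_runner hr] at h2
    refine ⟨by nlinarith, h2, ?_⟩
    rw [Nat.add_sub_add_left, ← Nat.mul_sub]
    exact Nat.mul_dvd_mul_left _ h3
  · intro u _ v _ h
    simpa [hq.ne'] using h
  · intro y hy
    simp only [mem_filter, mem_range] at hy ⊢
    obtain ⟨h1, h2, h3⟩ := hy
    obtain ⟨k, hk⟩ := h3
    have hy1 : r + q * t = y + q * (s * k) := by rw [← mul_assoc, ← hk]; omega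
    have hy2 : y % q = r := by
      have := congrArg (· % q) hy1
      simp only [add_mul_mod_of_lt hr, Nat.add_mul_mod_self_left] at this
      exact this.symm
    have hy3 : r + q * (y / q) = y := by rw [← hy2, Nat.mod_add_div]
    have e : t = y / q + s * k := by
      have : q * t = q * (y / q + s * k) := by rw [mul_add]; omega
      exact Nat.eq_of_mul_eq_mul_left hq this
    refine ⟨y / q, ⟨?_, ?_, ⟨k, by omega⟩⟩, hy3⟩
    · by_contra hlt
      have := Nat.mul_le_mul_left q (not_lt.mp hlt)
      omega
    · rw [mem_runner hr, hy3]; exact h2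

theorem weight_eq_sum {q : ℕ} (hq : 0 < q) (X : Finset ℕ) :
    weight q X = ∑ r ∈ range q, weight 1 (runner q r X) := by
  simpa using weight_runner (s := 1) hq X

theorem sum_card_range_inter (X : Finset ℕ) : ∑ x ∈ X, #{y ∈ range x | y ∈ X} = X.card.choose 2 := by
  induction X using Finset.induction_on_max with
  | empty => simp
  | insert a s ha ih =>
    have hna : a ∉ s := fun h => lt_irrefl _ (ha a h)
    rw [sum_insert hna, card_insert_of_notMem hna, Nat.choose_succ_succ' s.card 1, ← ih]
    congr 1
    · rw [Nat.choose_one_right]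
      congr 1
      ext y
      simp only [mem_filter, mem_range, mem_insert]
      constructor
      · rintro ⟨h1, h2⟩
        exact h2.resolve_left (by omega)
      · exact fun h => ⟨ha y h, Or.inr h⟩
    · refine sum_congr rfl fun x hx => ?_
      congr 1
      ext y
      have := ha x hx
      simp only [mem_filter, mem_range, mem_insert]
      constructor
      · rintro ⟨h1, h2⟩
        exact ⟨h1, h2.resolve_left (by omega)⟩
      · exact fun h => ⟨h.1, Or.inr h.2⟩

theorem sum_eq_weight (X : Finset ℕ) : ∑ x ∈ X, x = weight 1 X + X.card.choose 2 := by
  rw [← sum_card_range_inter, weight, ← sum_add_distrib]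
  refine sum_congr rfl fun x _ => ?_
  rw [add_comm]
  simpa using (card_filter_add_card_filter_not (s := range x) (fun y => y ∈ X)).symm

theorem weight_one_range (n : ℕ) : weight 1 (range n) = 0 := by
  unfold weight
  refine sum_eq_zero fun x hx => ?_
  rw [card_eq_zero, filter_eq_empty_iff]
  simp only [mem_range] at *
  intro y hy; omega

/-- Compare bead sums: pushing a runner down to its core lowers the sum by `q` for each pair of a
bead and a lower gap on it. -/
theorem weight_one_eq {q : ℕ} (hq : 0 < q) (X : Finset ℕ) :
    weight 1 X = weight 1 (qcore q X) + q * weight q X := by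
  have h1 := sum_eq_weight X
  have h2 := sum_eq_weight (qcore q X)
  rw [card_qcore hq] at h2
  have h3 : ∑ x ∈ X, x = ∑ x ∈ qcore q X, x + q * weight q X := by
    rw [sum_runner hq, sum_runner hq (qcore q X), weight_eq_sum hq, mul_sum, ← sum_add_distrib]
    refine sum_congr rfl fun r hr => ?_
    rw [runner_qcore (mem_range.mp hr), sum_add_distrib, sum_add_distrib, ← mul_sum, ← mul_sum,
      sum_eq_weight, sum_eq_weight, weight_one_range]
    simp
    ring
  omega

theorem weight_qcore_self {q : ℕ} (hq : 0 < q) (X : Finset ℕ) : weight q (qcore q X) = 0 := by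
  have := weight_one_eq hq (qcore q X)
  rw [qcore_idem hq] at this
  have : q * weight q (qcore q X) = 0 := by omega
  exact (Nat.mul_eq_zero.mp this).resolve_left hq.ne'

theorem qcore_eq_self_of_weight {q : ℕ} (hq : 0 < q) {X : Finset ℕ} (h : weight q X = 0) :
    qcore q X = X := by
  refine qcore_eq_self hq fun x hx hqx => ?_
  by_contra hn
  rw [weight, sum_eq_zero_iff] at h
  have := h x hx
  rw [card_eq_zero, filter_eq_empty_iff] at this
  exact this (x := x - q) (mem_range.mpr (by omega)) ⟨hn, ⟨1, by omega⟩⟩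

theorem qcore_eq_self_of_lt {q : ℕ} {X : Finset ℕ} (h : weight 1 X < q) :
    qcore q X = X := by
  have hq : 0 < q := by omega
  refine qcore_eq_self_of_weight hq ?_
  have := weight_one_eq hq X
  by_contra h0
  have : q * 1 ≤ q * weight q X := Nat.mul_le_mul_left _ (by omega)
  omega

/-- The size is computed from the `q`-core and from the `q * p`-core; both have the same `q`-core.
-/
theorem weight_eq_add {p q : ℕ} (hp : 0 < p) (hq : 0 < q) (X : Finset ℕ) :
    weight q X = weight q (qcore (q * p) X) + p * weight (q * p) X := by
  have h1 := weight_one_eq hq X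
  have h2 := weight_one_eq (Nat.mul_pos hq hp) X
  have h3 := weight_one_eq hq (qcore (q * p) X)
  rw [qcore_qcore_mul hq hp] at h3
  have : q * weight q X = q * (weight q (qcore (q * p) X) + p * weight (q * p) X) := by
    rw [mul_add, ← mul_assoc]; omega
  exact Nat.eq_of_mul_eq_mul_left hq this

/-! ### Containment of diagrams and shifts of beads -/

/-- The number of beads of `X` at or above `z`. -/
def above (z : ℕ) (X : Finset ℕ) : ℕ := #{x ∈ X | z ≤ x}

/-- The diagram of `Y` is contained in that of `X`. -/
def Dom (Y X : Finset ℕ) : Prop := Y.card = X.card ∧ ∀ z, above z Y ≤ above z X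

theorem Dom.refl (X : Finset ℕ) : Dom X X := ⟨rfl, fun _ => le_rfl⟩

theorem Dom.trans {X Y Z : Finset ℕ} (h : Dom X Y) (h' : Dom Y Z) : Dom X Z :=
  ⟨h.1.trans h'.1, fun z => (h.2 z).trans (h'.2 z)⟩

theorem above_zero (X : Finset ℕ) : above 0 X = X.card := by simp [above]

theorem above_succ (z : ℕ) (X : Finset ℕ) :
    above z X = above (z + 1) X + if z ∈ X then 1 else 0 := by
  unfold above
  split_ifs with h
  · have : X.filter (z ≤ ·) = insert z (X.filter (z + 1 ≤ ·)) := by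
      ext x; simp only [mem_filter, mem_insert]
      constructor
      · rintro ⟨h1, h2⟩
        by_cases hx : x = z
        · exact Or.inl hx
        · exact Or.inr ⟨h1, by omega⟩
      · rintro (rfl | ⟨h1, h2⟩)
        · exact ⟨h, le_rfl⟩
        · exact ⟨h1, by omega⟩
    rw [this, card_insert_of_notMem (by simp)]
  · rw [add_zero]
    congr 1
    ext x; simp only [mem_filter]
    constructor
    · rintro ⟨h1, h2⟩
      have : x ≠ z := fun e => h (e ▸ h1)
      exact ⟨h1, by omega⟩
    · rintro ⟨h1, h2⟩
      exact ⟨h1, by omega⟩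

theorem above_eq_zero {z : ℕ} {X : Finset ℕ} (h : ∀ x ∈ X, x < z) : above z X = 0 := by
  rw [above, card_eq_zero, filter_eq_empty_iff]
  intro x hx
  have := h x hx
  omega

theorem Dom.lt_of_lt {X Y : Finset ℕ} (h : Dom Y X) {b : ℕ} (hX : ∀ x ∈ X, x < b) :
    ∀ y ∈ Y, y < b := by
  intro y hy
  by_contra hn
  have h1 := h.2 b
  rw [above_eq_zero hX] at h1
  have : y ∈ Y.filter (b ≤ ·) := mem_filter.mpr ⟨hy, by omega⟩
  have := card_pos.mpr ⟨y, this⟩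
  unfold above at h1
  omega

/-- The beads in `S` are moved down by `δ`. -/
def shiftBeads (S : Finset ℕ) (δ : ℕ) (X : Finset ℕ) : Finset ℕ :=
  (X \ S) ∪ S.image (· - δ)

/-- The beads in `S` can be moved down by `δ`. -/
def Shiftable (S : Finset ℕ) (δ : ℕ) (X : Finset ℕ) : Prop :=
  S ⊆ X ∧ ∀ x ∈ S, δ ≤ x ∧ x - δ ∉ X

section
variable {S X : Finset ℕ} {δ : ℕ}

theorem card_filter_shiftBeads (h : Shiftable S δ X) (P : ℕ → Prop) [DecidablePred P] :
    #{x ∈ shiftBeads S δ X | P x} + #{x ∈ S | P x} = #{x ∈ X | P x} + #{x ∈ S | P (x - δ)} := by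
  have hd : Disjoint (X \ S) (S.image (· - δ)) := by
    rw [disjoint_left]
    intro x hx hx'
    obtain ⟨y, hy, rfl⟩ := mem_image.mp hx'
    exact (h.2 y hy).2 (mem_sdiff.mp hx).1
  have h1 : #{x ∈ S.image (· - δ) | P x} = #{x ∈ S | P (x - δ)} := by
    rw [filter_image, card_image_of_injOn]
    intro x hx y hy hxy
    simp only [coe_filter, Set.mem_ofPred_eq] at hx hy
    have := (h.2 x hx.1).1
    have := (h.2 y hy.1).1
    simp only at hxy
    omega
  rw [shiftBeads, filter_union, card_union_of_disjoint (disjoint_filter_filter hd), h1]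
  have h2 : #{x ∈ X | P x} = #{x ∈ X \ S | P x} + #{x ∈ S | P x} := by
    rw [← card_union_of_disjoint (disjoint_filter_filter sdiff_disjoint), ← filter_union,
      sdiff_union_of_subset h.1]
  omega

theorem card_shiftBeads (h : Shiftable S δ X) : (shiftBeads S δ X).card = X.card := by
  have := card_filter_shiftBeads h (fun _ => True)
  simpa using this

theorem above_shiftBeads (h : Shiftable S δ X) (z : ℕ) :
    above z (shiftBeads S δ X) + #{x ∈ S | z ≤ x ∧ x < z + δ} = above z X := by
  have h1 := card_filter_shiftBeads h (z ≤ ·)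
  have h2 : #{x ∈ S | z ≤ x} = #{x ∈ S | z ≤ x ∧ x < z + δ} + #{x ∈ S | z ≤ x - δ} := by
    rw [← card_union_of_disjoint]
    · congr 1
      ext x
      simp only [mem_filter, mem_union]
      constructor
      · rintro ⟨h1, h2⟩
        by_cases hx : x < z + δ
        · exact Or.inl ⟨h1, h2, hx⟩
        · exact Or.inr ⟨h1, by omega⟩
      · rintro (⟨h1, h2, -⟩ | ⟨h1, h2⟩)
        · exact ⟨h1, h2⟩
        · exact ⟨h1, by omega⟩
    · rw [disjoint_left]
      intro x hx hx'
      simp only [mem_filter] at hx hx'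
      have := (h.2 x hx.1).1
      omega
  unfold above
  omega

theorem dom_shiftBeads (h : Shiftable S δ X) : Dom (shiftBeads S δ X) X :=
  ⟨card_shiftBeads h, fun z => by have := above_shiftBeads h z; omega⟩

theorem weight_one_shiftBeads (h : Shiftable S δ X) :
    weight 1 (shiftBeads S δ X) + S.card * δ = weight 1 X := by
  have h1 := sum_eq_weight X
  have h2 := sum_eq_weight (shiftBeads S δ X)
  rw [card_shiftBeads h] at h2
  have hd : Disjoint (X \ S) (S.image (· - δ)) := by
    rw [disjoint_left]
    intro x hx hx'
    obtain ⟨y, hy, rfl⟩ := mem_image.mp hx'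
    exact (h.2 y hy).2 (mem_sdiff.mp hx).1
  have h3 : ∑ x ∈ S.image (· - δ), x = ∑ x ∈ S, (x - δ) := by
    apply sum_image
    intro x hx y hy hxy
    have := (h.2 x hx).1
    have := (h.2 y hy).1
    simp only at hxy
    omega
  have h4 : ∑ x ∈ S, (x - δ) + S.card * δ = ∑ x ∈ S, x := by
    rw [← smul_eq_mul, ← sum_const, ← sum_add_distrib]
    exact sum_congr rfl fun x hx => Nat.sub_add_cancel (h.2 x hx).1
  have h5 : ∑ x ∈ shiftBeads S δ X, x = ∑ x ∈ X \ S, x + ∑ x ∈ S, (x - δ) := by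
    rw [shiftBeads, sum_union hd, h3]
  have h6 := sum_sdiff (f := fun x => x) h.1
  omega

theorem card_runner_shiftBeads (h : Shiftable S δ X) (q r : ℕ) :
    (runner q r (shiftBeads S δ X)).card + #{x ∈ S | x % q = r} =
      (runner q r X).card + #{x ∈ S | (x - δ) % q = r} := by
  rw [card_runner, card_runner]
  exact card_filter_shiftBeads h _

end

/-- Moving a bead down by `q` to a free place removes a rim hook of `q` boxes and keeps all runner
counts. -/
theorem exists_hook_removal {q : ℕ} (hq : 0 < q) {X : Finset ℕ} (h : 0 < weight q X) :
    ∃ Y, Dom Y X ∧ qcore q Y = qcore q X ∧ weight q Y + 1 = weight q X := by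
  have : ∃ x ∈ X, q ≤ x ∧ x - q ∉ X := by
    by_contra! hn
    have h1 := weight_qcore_self hq X
    rw [qcore_eq_self hq hn] at h1
    omega
  obtain ⟨x, hx, hqx, hn⟩ := this
  have hs : Shiftable {x} q X := ⟨by simpa using hx, by simpa using ⟨hqx, hn⟩⟩
  have hc : qcore q (shiftBeads {x} q X) = qcore q X := by
    refine qcore_congr hq fun r hr => ?_
    have := card_runner_shiftBeads hs q r
    have e : (x - q) % q = x % q := by
      conv_rhs => rw [← Nat.sub_add_cancel hqx]
      simp
    simp only [filter_singleton, e] at this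
    omega
  refine ⟨_, dom_shiftBeads hs, hc, ?_⟩
  have h1 := weight_one_shiftBeads hs
  have h2 := weight_one_eq hq X
  have h3 := weight_one_eq hq (shiftBeads {x} q X)
  rw [hc] at h3
  simp only [card_singleton, one_mul] at h1
  have : q * (weight q (shiftBeads {x} q X) + 1) = q * weight q X := by rw [mul_add]; omega
  exact Nat.eq_of_mul_eq_mul_left hq this

theorem exists_weight_eq {q : ℕ} (hq : 0 < q) {X : Finset ℕ} {w : ℕ} (h : w ≤ weight q X) :
    ∃ Y, Dom Y X ∧ qcore q Y = qcore q X ∧ weight q Y = w := by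
  obtain ⟨d, hd⟩ := Nat.exists_eq_add_of_le h
  induction d generalizing X with
  | zero => exact ⟨X, Dom.refl X, rfl, by omega⟩
  | succ d ih =>
    obtain ⟨Y, h1, h2, h3⟩ := exists_hook_removal hq (X := X) (by omega)
    obtain ⟨Z, h4, h5, h6⟩ := ih (X := Y) (by omega) (by omega)
    exact ⟨Z, h4.trans h1, h5.trans h2, h6⟩

theorem dom_qcore {q : ℕ} (hq : 0 < q) (X : Finset ℕ) : Dom (qcore q X) X := by
  obtain ⟨Y, h1, h2, h3⟩ := exists_weight_eq hq (X := X) (w := 0) (by omega)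
  rw [← h2, qcore_eq_self_of_weight hq h3]
  exact h1

/-! ### Shrinking the core at constant weight -/

section
variable {q : ℕ} {C D X : Finset ℕ}

/-- The surplus that `C` gains at `x` persists at lower thresholds until a bead of `D \ C` is met.
The next lemma is the same argument upwards from a bead of `D \ C`. -/
theorem above_lt_of_mem_sdiff (hdom : Dom D C) {x : ℕ} (hx : x ∈ C \ D) (d : ℕ) (hd : d ≤ x)
    (h : ∀ y ∈ D \ C, x - d ≤ y → x < y) : above (x - d) D < above (x - d) C := by
  induction d with
  | zero =>
    have h1 := above_succ x D
    have h2 := above_succ x C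
    have h3 := hdom.2 (x + 1)
    rw [mem_sdiff] at hx
    simp only [hx.1, hx.2, if_true, if_false] at h1 h2
    simp only [Nat.sub_zero]
    omega
  | succ d ih =>
    have ih := ih (by omega) (fun y hy hy' => h y hy (by omega))
    have h1 := above_succ (x - (d + 1)) D
    have h2 := above_succ (x - (d + 1)) C
    have e : x - (d + 1) + 1 = x - d := by omega
    rw [e] at h1 h2
    have : x - (d + 1) ∈ D → x - (d + 1) ∈ C := by
      intro h3
      by_contra h4
      have := h _ (mem_sdiff.mpr ⟨h3, h4⟩) le_rfl
      omega
    split_ifs at h1 h2 <;> first | omega | tauto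

theorem above_lt_of_mem_sdiff' (hdom : Dom D C) {y : ℕ} (hy : y ∈ D \ C) (d : ℕ)
    (h : ∀ x ∈ C \ D, y < x → y + d < x) : above (y + 1 + d) D < above (y + 1 + d) C := by
  induction d with
  | zero =>
    have h1 := above_succ y D
    have h2 := above_succ y C
    have h3 := hdom.2 y
    rw [mem_sdiff] at hy
    simp only [hy.1, hy.2, if_true, if_false] at h1 h2
    rw [add_zero]
    omega
  | succ d ih =>
    have ih := ih (fun x hx hx' => by have := h x hx hx'; omega)
    have h1 := above_succ (y + 1 + d) D
    have h2 := above_succ (y + 1 + d) C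
    have : y + 1 + d ∈ C → y + 1 + d ∈ D := by
      intro h3
      by_contra h4
      have := h _ (mem_sdiff.mpr ⟨h3, h4⟩) (by omega)
      omega
    rw [← add_assoc]
    split_ifs at h1 h2 <;> first | omega | tauto

theorem sub_mod_eq {a b δ x : ℕ} (hab : b + δ = a) (hx : x % q = a % q) (h : δ ≤ x) :
    (x - δ) % q = b % q := by
  have : (x - δ + δ) ≡ b + δ [MOD q] := by
    rw [Nat.sub_add_cancel h, hab]; exact hx
  exact Nat.ModEq.add_right_cancel' δ this

theorem dvd_sub_of_mod_eq {x y : ℕ} (h : x % q = y % q) : q ∣ x - y := by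
  rcases le_total y x with h' | h'
  · exact (Nat.modEq_iff_dvd' h').mp h.symm
  · simp [Nat.sub_eq_zero_of_le h']

/-- A closest pair is taken. Pairs with `y < x` exist: if all of `C \ D` lay below some `y ∈ D \ C`,
then `D` would have more beads than `C` from `y` on. -/
theorem exists_minimal_gap (hdom : Dom D C) (hne : D ≠ C) :
    ∃ b δ, 0 < δ ∧ b + δ ∈ C \ D ∧ b ∈ D \ C ∧
      ∀ x ∈ C \ D, ∀ y ∈ D \ C, y < x → y + δ ≤ x := by
  let P := ((C \ D) ×ˢ (D \ C)).filter fun u => u.2 < u.1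
  have hP : P.Nonempty := by
    have hcard : (C \ D).card = (D \ C).card := card_sdiff_comm hdom.1.symm
    have h1 : (D \ C).Nonempty := by
      rw [nonempty_iff_ne_empty]
      intro h0
      rw [sdiff_eq_empty_iff_subset] at h0
      exact hne (eq_of_subset_of_card_le h0 hdom.1.symm.le)
    obtain ⟨y, hy⟩ := h1
    have hx : (C \ D).Nonempty := card_pos.mp (hcard ▸ card_pos.mpr ⟨y, hy⟩)
    by_contra hn
    rw [not_nonempty_iff_eq_empty, filter_eq_empty_iff] at hn
    have hxy : ∀ x ∈ C \ D, x < y := by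
      intro x hx
      have := hn (mk_mem_product hx hy)
      simp only [not_lt] at this
      refine lt_of_le_of_ne this ?_
      rintro rfl
      exact (mem_sdiff.mp hy).2 (mem_sdiff.mp hx).1
    have h2 : C.filter (y ≤ ·) ⊂ D.filter (y ≤ ·) := by
      rw [ssubset_iff_of_subset]
      · exact ⟨y, by simp [(mem_sdiff.mp hy).1], by simp [(mem_sdiff.mp hy).2]⟩
      · intro x hx
        rw [mem_filter] at hx ⊢
        refine ⟨?_, hx.2⟩
        by_contra hxD
        have := hxy x (mem_sdiff.mpr ⟨hx.1, hxD⟩)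
        omega
    have h3 := card_lt_card h2
    have h4 := hdom.2 y
    unfold above at h4
    omega
  obtain ⟨⟨a, b⟩, hab, hmin⟩ := exists_min_image P (fun u => u.1 - u.2) hP
  simp only [P, mem_filter, mem_product] at hab hmin
  refine ⟨b, a - b, by omega, ?_, hab.1.2, fun x hx y hy hyx => ?_⟩
  · rw [Nat.add_sub_cancel' hab.2.le]; exact hab.1.1
  · have := hmin (x, y) ⟨⟨hx, hy⟩, hyx⟩
    simp only at this
    omega

/-- A core depends only on the runner counts, and both shifts carry equally many beads between the
same two runners. -/
theorem qcore_shiftBeads (hq : 0 < q) {S T : Finset ℕ} {δ ε i j : ℕ}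
    (hS : Shiftable S δ X) (hT : Shiftable T ε (qcore q X))
    (hSi : ∀ x ∈ S, x % q = i) (hTi : ∀ x ∈ T, x % q = i)
    (hSj : ∀ x ∈ S, (x - δ) % q = j) (hTj : ∀ x ∈ T, (x - ε) % q = j)
    (hc : S.card = T.card) (hcore : qcore q (shiftBeads T ε (qcore q X)) = shiftBeads T ε (qcore q X)) :
    qcore q (shiftBeads S δ X) = shiftBeads T ε (qcore q X) := by
  rw [← hcore]
  refine qcore_congr hq fun r hr => ?_
  have h1 := card_runner_shiftBeads hS q r
  have h2 := card_runner_shiftBeads hT q r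
  rw [runner_qcore hr, card_range] at h2
  have e : ∀ (U : Finset ℕ) (g : ℕ → ℕ) (k : ℕ), (∀ x ∈ U, g x = k) →
      #{x ∈ U | g x = r} = if k = r then U.card else 0 := by
    intro U g k h
    split_ifs with hk
    · rw [filter_true_of_mem]
      intro x hx; rw [h x hx, hk]
    · rw [card_eq_zero, filter_eq_empty_iff]
      intro x hx; rwa [h x hx]
  rw [e S _ i hSi, e S _ j hSj] at h1
  rw [e T _ i hTi, e T _ j hTj] at h2
  rw [hc] at h1
  omega

/-- Transfers a shift available in the core to `X` itself, where the beads need to move only by `δ %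
q`. This is a count of beads on the two runners. -/
theorem exists_shiftable (hq : 0 < q) {b δ : ℕ} (ha : b + δ ∈ qcore q X) (hb : b ∉ qcore q X)
    {T : Finset ℕ} (hT : ∀ x ∈ T, x ∈ qcore q X ∧ x % q = (b + δ) % q ∧ δ ≤ x ∧ x - δ ∉ qcore q X) :
    ∃ S, Shiftable S (δ % q) X ∧ (∀ x ∈ S, x % q = (b + δ) % q) ∧ S.card = T.card := by
  set C := qcore q X with hC
  have hCC : qcore q C = C := qcore_idem hq X
  set δ₀ := δ % q with hδ₀
  have hδ₀q : δ₀ < q := Nat.mod_lt _ hq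
  have hδ₀δ : δ₀ ≤ δ := Nat.mod_le _ _
  have hcardX : ∀ r, r < q → #{x ∈ C | x % q = r} = #{x ∈ X | x % q = r} := by
    intro r hr
    rw [← card_runner, ← card_runner, hC, runner_qcore hr, card_range]
  have hi := hcardX _ (Nat.mod_lt (b + δ) hq)
  have hj := hcardX _ (Nat.mod_lt b hq)
  -- Beads of `C` on the runner of `b` lie below `b`, so their translates by `δ` are beads of `C`
  -- below `b + δ`; none of them belongs to `T`.
  have h1 : T.card + #{x ∈ C | x % q = b % q} ≤ #{x ∈ C | x % q = (b + δ) % q ∧ δ₀ ≤ x} := by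
    have : ({x ∈ C | x % q = b % q}).card = ({x ∈ C | x % q = b % q}.image (· + δ)).card :=
      (card_image_of_injective _ (add_left_injective δ)).symm
    rw [this, ← card_union_of_disjoint]
    · apply card_le_card
      intro x hx
      simp only [mem_union, mem_image, mem_filter] at hx ⊢
      rcases hx with hx | ⟨y, ⟨hyC, hy⟩, rfl⟩
      · obtain ⟨h1, h2, h3, h4⟩ := hT x hx
        exact ⟨h1, h2, by omega⟩
      · have hyb : y < b := by
          by_contra hlt
          exact hb (sub_mem_of_qcore_eq hq hCC hyC b (not_lt.mp hlt) (dvd_sub_of_mod_eq hy))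
        have hmod : (y + δ) % q = (b + δ) % q := Nat.ModEq.add_right δ hy
        exact ⟨sub_mem_of_qcore_eq hq hCC ha _ (by omega) (dvd_sub_of_mod_eq hmod.symm), hmod,
          by omega⟩
    · rw [disjoint_left]
      intro x hx hx'
      simp only [mem_image, mem_filter] at hx'
      obtain ⟨y, ⟨hyC, hy⟩, rfl⟩ := hx'
      exact (hT _ hx).2.2.2 (by simpa using hyC)
  -- The runner has equally many beads in `C` and `X`. Below `δ₀ < q` it has at most one place,
  -- which is filled in `C` whenever it is in `X`.
  have h2 : #{x ∈ C | x % q = (b + δ) % q ∧ δ₀ ≤ x} ≤ #{x ∈ X | x % q = (b + δ) % q ∧ δ₀ ≤ x} := by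
    have e : ∀ Z : Finset ℕ, #{x ∈ Z | x % q = (b + δ) % q ∧ δ₀ ≤ x} +
        #{x ∈ Z | x % q = (b + δ) % q ∧ ¬ δ₀ ≤ x} = #{x ∈ Z | x % q = (b + δ) % q} := by
      intro Z
      rw [← filter_filter, ← filter_filter]
      exact card_filter_add_card_filter_not _
    have h3 := e C
    have h4 := e X
    have h5 : #{x ∈ X | x % q = (b + δ) % q ∧ ¬ δ₀ ≤ x} ≤
        #{x ∈ C | x % q = (b + δ) % q ∧ ¬ δ₀ ≤ x} := by
      apply card_le_card
      intro x hx
      rw [mem_filter] at hx ⊢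
      refine ⟨?_, hx.2⟩
      have hxq : x < q := by omega
      rw [hC, mem_qcore hq, Nat.div_eq_of_lt hxq, card_pos]
      exact ⟨x / q, (div_mem_runner hq).mpr hx.1⟩
    omega
  -- Beads blocked from moving down by `δ₀` inject into the beads on the runner of `b`.
  have h3 : #{x ∈ X | x % q = (b + δ) % q ∧ δ₀ ≤ x} ≤
      #{x ∈ X | (x % q = (b + δ) % q ∧ δ₀ ≤ x) ∧ x - δ₀ ∉ X} + #{x ∈ X | x % q = b % q} := by
    have e := card_filter_add_card_filter_not (s := {x ∈ X | x % q = (b + δ) % q ∧ δ₀ ≤ x})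
      (fun x => x - δ₀ ∉ X)
    rw [filter_filter] at e
    rw [← e]
    refine Nat.add_le_add_left ?_ _
    apply card_le_card_of_injOn (· - δ₀)
    · intro x hx
      simp only [not_not, coe_filter, mem_filter, Set.mem_ofPred_eq] at hx ⊢
      refine ⟨hx.2, ?_⟩
      refine sub_mod_eq (a := b + δ₀) rfl ?_ hx.1.2.2
      rw [hx.1.2.1, Nat.add_mod b δ, Nat.add_mod b δ₀, Nat.mod_eq_of_lt hδ₀q]
    · intro x hx y hy hxy
      simp only [not_not, coe_filter, mem_filter, Set.mem_ofPred_eq] at hx hy hxy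
      omega
  obtain ⟨S, hS, hSc⟩ := exists_subset_card_eq (s := X.filter fun x =>
    (x % q = (b + δ) % q ∧ δ₀ ≤ x) ∧ x - δ₀ ∉ X) (n := T.card) (by omega)
  have hS' : ∀ x ∈ S, x ∈ X ∧ (x % q = (b + δ) % q ∧ δ₀ ≤ x) ∧ x - δ₀ ∉ X :=
    fun x hx => mem_filter.mp (hS hx)
  exact ⟨S, ⟨fun x hx => (hS' x hx).1, fun x hx => ⟨(hS' x hx).2.1.2, (hS' x hx).2.2⟩⟩,
    fun x hx => (hS' x hx).2.1.1, hSc⟩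

end

section
variable {q : ℕ} {D X : Finset ℕ}

theorem mem_shiftBeads {S : Finset ℕ} {δ x : ℕ} :
    x ∈ shiftBeads S δ X ↔ (x ∈ X ∧ x ∉ S) ∨ ∃ y ∈ S, y - δ = x := by
  simp [shiftBeads]

theorem mod_ne_of_mem_qcore (hq : 0 < q) {b δ : ℕ} (ha : b + δ ∈ qcore q X)
    (hb : b ∉ qcore q X) : b % q ≠ (b + δ) % q := fun h =>
  hb (sub_mem_of_qcore_eq hq (qcore_idem hq X) ha b (by omega) (dvd_sub_of_mod_eq h.symm))

/-- If a `q`-core `D` is properly contained in the `q`-core of `X`, then the latter can be reduced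
by moving beads from one runner to another. -/
theorem exists_core_shift (hq : 0 < q) (hD : qcore q D = D) (hdom : Dom D (qcore q X))
    (hne : D ≠ qcore q X) :
    ∃ b δ ε T, b + δ ∈ qcore q X ∧ b ∉ qcore q X ∧ T.Nonempty ∧ 0 < ε ∧ δ % q ≤ ε ∧
      (∀ x ∈ T, x % q = (b + δ) % q ∧ (x - ε) % q = b % q) ∧
      (∃ T' : Finset ℕ, T'.card = T.card ∧ ∀ x ∈ T', x ∈ qcore q X ∧ x % q = (b + δ) % q ∧ δ ≤ x ∧
        x - δ ∉ qcore q X) ∧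
      Shiftable T ε (qcore q X) ∧ Dom D (shiftBeads T ε (qcore q X)) ∧
      qcore q (shiftBeads T ε (qcore q X)) = shiftBeads T ε (qcore q X) := by
  obtain ⟨b, δ, hδ, ha, hb, hmin⟩ := exists_minimal_gap hdom hne
  have hCC : qcore q (qcore q X) = qcore q X := qcore_idem hq X
  have haC := (mem_sdiff.mp ha).1
  have haD := (mem_sdiff.mp ha).2
  have hbD := (mem_sdiff.mp hb).1
  have hbC := (mem_sdiff.mp hb).2
  have hab := mod_ne_of_mem_qcore hq haC hbC
  set C := qcore q X with hC
  have hup : ∀ x ∈ C, x % q = (b + δ) % q → b + δ ≤ x → x ∈ C \ D := by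
    intro x hx hxa hle
    refine mem_sdiff.mpr ⟨hx, fun hxD => haD ?_⟩
    exact sub_mem_of_qcore_eq hq hD hxD _ hle (dvd_sub_of_mod_eq hxa)
  have hdown : ∀ y, y ∉ C → y % q = b % q → y ≤ b → y ∈ D \ C := by
    intro y hy hyb hle
    exact mem_sdiff.mpr ⟨sub_mem_of_qcore_eq hq hD hbD _ hle (dvd_sub_of_mod_eq hyb.symm), hy⟩
  -- By minimality of `δ`, containment is strict at all thresholds within `δ` below a bead of `C \
  -- D`, and likewise above a bead of `D \ C`. A bead crossing such a threshold does no harm.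
  have hgap : ∀ x ∈ C \ D, ∀ z ≤ x, x < z + δ → above z D < above z C := by
    intro x hx z hzx hz
    have := above_lt_of_mem_sdiff hdom hx (x - z) (by omega) (fun y hy hy' => by
      by_contra hlt
      rcases (not_lt.mp hlt).lt_or_eq with h | h
      · have := hmin x hx y hy h
        omega
      · rw [h] at hy
        exact (mem_sdiff.mp hx).2 (mem_sdiff.mp hy).1)
    rwa [Nat.sub_sub_self hzx] at this
  have hgap' : ∀ y ∈ D \ C, ∀ z, y < z → z ≤ y + δ → above z D < above z C := by
    intro y hy z hyz hz
    have := above_lt_of_mem_sdiff' hdom hy (z - y - 1) (fun x hx hx' => by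
      have := hmin x hx y hy hx'
      omega)
    rwa [show y + 1 + (z - y - 1) = z by omega] at this
  -- For `δ < q`, every bead on the runner of `b + δ` whose place `δ` lower is free moves there.
  by_cases hδq : δ < q
  · let T := {x ∈ C | x % q = (b + δ) % q ∧ δ ≤ x ∧ x - δ ∉ C}
    have hT : ∀ x ∈ T, x ∈ C ∧ x % q = (b + δ) % q ∧ δ ≤ x ∧ x - δ ∉ C :=
      fun x hx => mem_filter.mp hx
    have hTmod : ∀ x ∈ T, (x - δ) % q = b % q := fun x hx =>
      sub_mod_eq rfl (hT x hx).2.1 (hT x hx).2.2.1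
    have hs : Shiftable T δ C := ⟨filter_subset _ _, fun x hx => (hT x hx).2.2⟩
    refine ⟨b, δ, δ, T, haC, hbC, ⟨b + δ, mem_filter.mpr ⟨haC, rfl, by omega, by simpa⟩⟩, hδ,
      Nat.mod_le _ _, fun x hx => ⟨(hT x hx).2.1, hTmod x hx⟩, ⟨T, rfl, hT⟩, hs, ⟨?_, ?_⟩, ?_⟩
    · rw [card_shiftBeads hs]; exact hdom.1
    · intro z
      have h1 := above_shiftBeads hs z
      -- Beads on one runner are at least `q > δ` apart, so at most one crosses `z`.
      have h2 : #{x ∈ T | z ≤ x ∧ x < z + δ} ≤ 1 := by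
        rw [card_le_one]
        intro x hx y hy
        simp only [mem_filter (s := T)] at hx hy
        have e1 := (hT x hx.1).2.1
        have e2 := (hT y hy.1).2.1
        wlog hxy : x ≤ y generalizing x y
        · exact (this y x hy hx e2 e1 (by omega)).symm
        obtain ⟨k, hk⟩ := dvd_sub_of_mod_eq (e2.trans e1.symm)
        rcases Nat.eq_zero_or_pos k with rfl | hk0
        · omega
        · have := Nat.mul_le_mul_left q hk0
          omega
      rcases Nat.eq_zero_or_pos #{x ∈ T | z ≤ x ∧ x < z + δ} with h0 | h0
      · have := hdom.2 z
        omega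
      · obtain ⟨x, hx⟩ := card_pos.mp h0
        obtain ⟨hxT, hzx, hxz⟩ := mem_filter.mp hx
        obtain ⟨hxC, hxa, hδx, hxδ⟩ := hT x hxT
        have : above z D < above z C := by
          rcases le_total (b + δ) x with hle | hle
          · exact hgap x (hup x hxC hxa hle) z hzx hxz
          · exact hgap' (x - δ) (hdown _ hxδ (hTmod x hxT) (by omega)) z (by omega) (by omega)
        omega
    · apply qcore_eq_self hq
      intro x hx hqx
      rw [mem_shiftBeads] at hx ⊢
      rcases hx with ⟨hxC, hxT⟩ | ⟨y, hy, rfl⟩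
      · have hxq : x - q ∈ C := sub_mem_of_qcore_eq hq hCC hxC _ (by omega) ⟨1, by omega⟩
        refine Or.inl ⟨hxq, fun hT' => hxT ?_⟩
        obtain ⟨-, h1, h2, h3⟩ := hT _ hT'
        refine mem_filter.mpr ⟨hxC, ?_, by omega, fun h4 => h3 ?_⟩
        · rw [← h1]
          conv_lhs => rw [← Nat.sub_add_cancel hqx]
          simp
        · exact sub_mem_of_qcore_eq hq hCC h4 _ (by omega) ⟨1, by omega⟩
      · obtain ⟨h1, h2, h3, h4⟩ := hT _ hy
        have hyq : y - q ∈ C := sub_mem_of_qcore_eq hq hCC h1 _ (by omega) ⟨1, by omega⟩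
        have hyq' : (y - q) % q = y % q := by
          conv_rhs => rw [← Nat.sub_add_cancel (show q ≤ y by omega)]
          simp
        by_cases h5 : y - q - δ ∈ C
        · have e : y - q - δ = y - δ - q := by omega
          rw [e] at h5
          refine Or.inl ⟨h5, fun h6 => hab ?_⟩
          rw [← (hT _ h6).2.1, ← hTmod y hy]
          conv_lhs => rw [← Nat.sub_add_cancel hqx]
          simp
        · exact Or.inr ⟨y - q, mem_filter.mpr ⟨hyq, hyq'.trans h2, by omega, h5⟩, by omega⟩
  -- For `δ ≥ q` several beads could cross one threshold. Instead only the top bead on the runner of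
  -- `b + δ` moves, to the lowest gap on the runner of `b`.
  · have hA : ({x ∈ C | x % q = (b + δ) % q}).Nonempty := ⟨b + δ, mem_filter.mpr ⟨haC, rfl⟩⟩
    obtain ⟨a', ha', hamax⟩ := exists_max_image _ id hA
    have hB : ({y ∈ range (b + 1) | y ∉ C ∧ y % q = b % q}).Nonempty :=
      ⟨b, mem_filter.mpr ⟨by simp, hbC, rfl⟩⟩
    obtain ⟨b', hb', hbmin⟩ := exists_min_image _ id hB
    simp only [mem_filter, mem_range, id] at ha' hamax hb' hbmin
    have haa : b + δ ≤ a' := hamax _ ⟨haC, rfl⟩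
    have hbb : b' ≤ b := by omega
    have hεb : a' - (a' - b') = b' := by omega
    have hs : Shiftable {a'} (a' - b') C :=
      ⟨by simpa using ha'.1, by simpa [hεb] using hb'.2.1⟩
    refine ⟨b, δ, a' - b', {a'}, haC, hbC, by simp, by omega, (Nat.mod_le δ q).trans (by omega),
      by simpa [hεb] using ⟨ha'.2, hb'.2.2⟩, ⟨{b + δ}, by simp, by simpa using ⟨haC, hbC⟩⟩, hs,
      ⟨?_, ?_⟩, ?_⟩
    · rw [card_shiftBeads hs]; exact hdom.1
    · intro z
      have h1 := above_shiftBeads hs z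
      rw [filter_singleton] at h1
      split_ifs at h1 with h2
      · rw [card_singleton] at h1
        have : above z D < above z C := by
          rcases lt_or_ge b z with hbz | hbz
          · rcases le_or_gt z (b + δ) with hz | hz
            · exact hgap _ ha z hz (by omega)
            · -- the least `x ≥ z` on the runner of `a'`
              let x := a' - q * ((a' - z) / q)
              have h3 := Nat.div_add_mod (a' - z) q
              have h4 := Nat.mod_lt (a' - z) hq
              have hxC : x ∈ C := sub_mem_of_qcore_eq hq hCC ha'.1 _ (by omega)
                ⟨(a' - z) / q, by omega⟩
              have hxm : x % q = a' % q := by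
                have : a' = x + q * ((a' - z) / q) := by omega
                conv_rhs => rw [this]
                simp
              exact hgap x (hup x hxC (hxm.trans ha'.2) (by omega)) z (by omega) (by omega)
          · let y := b' + q * ((z - 1 - b') / q)
            have h3 := Nat.div_add_mod (z - 1 - b') q
            have h4 := Nat.mod_lt (z - 1 - b') hq
            have hyC : y ∉ C := fun h => hb'.2.1
              (sub_mem_of_qcore_eq hq hCC h _ (by omega) ⟨(z - 1 - b') / q, by omega⟩)
            have hym : y % q = b % q := by
              rw [← hb'.2.2]; simp [y]
            exact hgap' y (hdown y hyC hym (by omega)) z (by omega) (by omega)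
        omega
      · have := hdom.2 z
        simp only [card_empty] at h1
        omega
    · apply qcore_eq_self hq
      intro x hx hqx
      have hmod : (x - q) % q = x % q := by
        conv_rhs => rw [← Nat.sub_add_cancel hqx]
        simp
      rw [mem_shiftBeads] at hx ⊢
      rcases hx with ⟨hxC, hxT⟩ | ⟨y, hy, rfl⟩
      · have hxq : x - q ∈ C := sub_mem_of_qcore_eq hq hCC hxC _ (by omega) ⟨1, by omega⟩
        refine Or.inl ⟨hxq, fun h => ?_⟩
        rw [mem_singleton] at h
        have := hamax x ⟨hxC, by rw [← hmod, h, ha'.2]⟩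
        omega
      · rw [mem_singleton] at hy
        subst hy
        rw [hεb] at hmod hqx ⊢
        refine Or.inl ⟨?_, fun h => ?_⟩
        · by_contra hn
          have := hbmin _ ⟨by omega, hn, hmod.trans hb'.2.2⟩
          omega
        · rw [mem_singleton] at h
          omega

/-- In the core the beads descend by `ε`; in `X` equally many descend by only `δ % q ≤ ε`. The core
loses at least as many boxes as the diagram, so the `q`-weight cannot fall. -/
theorem exists_core_step (hq : 0 < q) (hD : qcore q D = D) (hdom : Dom D (qcore q X))
    (hne : D ≠ qcore q X) :
    ∃ Y, Dom Y X ∧ Dom D (qcore q Y) ∧ weight 1 (qcore q Y) < weight 1 (qcore q X) ∧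
      weight q X ≤ weight q Y := by
  obtain ⟨b, δ, ε, T, ha, hb, hT0, hε, hδε, hTmod, ⟨T', hT'c, hT'⟩, hs, hd, hc⟩ :=
    exists_core_shift hq hD hdom hne
  obtain ⟨S, hS, hSi, hSc⟩ := exists_shiftable hq ha hb hT'
  rw [hT'c] at hSc
  have hcore := qcore_shiftBeads hq hS hs hSi (fun x hx => (hTmod x hx).1)
    (fun x hx => sub_mod_eq (a := b + δ % q) rfl
      (by rw [hSi x hx, Nat.add_mod b δ, Nat.add_mod b (δ % q), Nat.mod_mod]) (hS.2 x hx).1)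
    (fun x hx => (hTmod x hx).2) hSc hc
  have h1 := weight_one_shiftBeads hS
  have h2 := weight_one_shiftBeads hs
  have h3 := weight_one_eq hq X
  have h4 := weight_one_eq hq (shiftBeads S (δ % q) X)
  have h5 : T.card * (δ % q) ≤ T.card * ε := Nat.mul_le_mul_left _ hδε
  have h6 : 0 < T.card * ε := Nat.mul_pos (card_pos.mpr hT0) hε
  refine ⟨_, dom_shiftBeads hS, by rw [hcore]; exact hd, by rw [hcore]; omega, ?_⟩
  rw [hcore] at h4
  rw [hSc] at h1
  have : q * weight q X ≤ q * weight q (shiftBeads S (δ % q) X) := by omega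
  exact Nat.le_of_mul_le_mul_left this hq

/-- The `q`-core of a diagram can be replaced by a smaller `q`-core without changing the
`q`-weight, by removing boxes. -/
theorem exists_qcore_eq_weight_eq (hq : 0 < q) (hD : qcore q D = D) (hdom : Dom D (qcore q X)) :
    ∃ Y, Dom Y X ∧ qcore q Y = D ∧ weight q Y = weight q X := by
  -- Excess `q`-weight can be removed at the end as `q`-hooks, which leaves the core alone.
  suffices ∃ Y, Dom Y X ∧ qcore q Y = D ∧ weight q X ≤ weight q Y by
    obtain ⟨Y, h1, h2, h3⟩ := this
    obtain ⟨Z, h4, h5, h6⟩ := exists_weight_eq hq h3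
    exact ⟨Z, h4.trans h1, h5.trans h2, h6⟩
  induction hn : weight 1 (qcore q X) using Nat.strong_induction_on generalizing X with
  | _ n ih =>
    by_cases hne : D = qcore q X
    · exact ⟨X, Dom.refl X, hne.symm, le_rfl⟩
    · obtain ⟨Y, h1, h2, h3, h4⟩ := exists_core_step hq hD hdom hne
      obtain ⟨Z, h5, h6, h7⟩ := ih _ (hn ▸ h3) h2 rfl
      exact ⟨Z, h5.trans h1, h6, h4.trans h7⟩

end

/-! ### Layers of the core tower -/

/-- The `L`th layer of the `p`-core tower above the `q`-core of `X`: the `q * p ^ L`-weight of the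
`q * p ^ (L + 1)`-core. -/
def layer (p q L : ℕ) (X : Finset ℕ) : ℕ := weight (q * p ^ L) (qcore (q * p ^ (L + 1)) X)

theorem weight_eq_zero_of_lt {q : ℕ} {X : Finset ℕ} (h : ∀ x ∈ X, x < q) : weight q X = 0 := by
  refine sum_eq_zero fun x hx => ?_
  rw [card_eq_zero, filter_eq_empty_iff]
  rintro y hy ⟨-, hd⟩
  rw [mem_range] at hy
  have := Nat.le_of_dvd (by omega) hd
  have := h x hx
  omega

section
variable {p q : ℕ} {D X Y : Finset ℕ}

theorem qcore_eq_self_of_forall_lt (hq : 0 < q) (h : ∀ x ∈ X, x < q) : qcore q X = X :=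
  qcore_eq_self_of_weight hq (weight_eq_zero_of_lt h)

theorem layer_mul (L : ℕ) : layer p (q * p) L X = layer p q (L + 1) X := by
  simp only [layer, pow_succ', mul_assoc]

theorem layer_zero : layer p q 0 X = weight q (qcore (q * p) X) := by simp [layer]

/-- The layers are base-`p` digits of the `q`-weight, except that they may be `p` or larger. -/
theorem weight_eq_sum_add (hp : 0 < p) (hq : 0 < q) (K : ℕ) (X : Finset ℕ) :
    weight q X = ∑ L ∈ range K, layer p q L X * p ^ L + p ^ K * weight (q * p ^ K) X := by
  induction K with
  | zero => simp
  | succ K ih =>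
    rw [ih, sum_range_succ, weight_eq_add hp (Nat.mul_pos hq (pow_pos hp K)) X, layer, mul_assoc q,
      ← pow_succ]
    ring

theorem weight_one_qcore_pow (hp : 0 < p) (hq : 0 < q) (K : ℕ) (X : Finset ℕ) :
    weight 1 (qcore (q * p ^ K) X) =
      weight 1 (qcore q X) + q * ∑ L ∈ range K, layer p q L X * p ^ L := by
  have h1 := weight_one_eq hq X
  have h2 := weight_one_eq (Nat.mul_pos hq (pow_pos hp K)) X
  rw [weight_eq_sum_add hp hq K X, mul_add, ← mul_assoc] at h1
  omega

theorem exists_forall_lt_mul_pow (hp : 2 ≤ p) (hq : 0 < q) (X : Finset ℕ) :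
    ∃ K₀, ∀ K ≥ K₀, ∀ x ∈ X, x < q * p ^ K := by
  refine ⟨X.sup id, fun K hK x hx => ?_⟩
  have h1 : x ≤ X.sup id := le_sup (f := id) hx
  have h2 : K < p ^ K := Nat.lt_pow_self (by omega)
  nlinarith

theorem exists_weight_eq_sum (hp : 2 ≤ p) (hq : 0 < q) (X : Finset ℕ) :
    ∃ K₀, ∀ K ≥ K₀, weight q X = ∑ L ∈ range K, layer p q L X * p ^ L := by
  obtain ⟨K₀, hK⟩ := exists_forall_lt_mul_pow hp hq X
  refine ⟨K₀, fun K h => ?_⟩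
  rw [weight_eq_sum_add (p := p) (by omega) hq K X, weight_eq_zero_of_lt (hK K h), mul_zero, add_zero]

theorem weight_congr (hp : 2 ≤ p) (hq : 0 < q) (h : ∀ L, layer p q L X = layer p q L Y) :
    weight q X = weight q Y := by
  obtain ⟨K, hK⟩ := exists_weight_eq_sum hp hq X
  obtain ⟨K', hK'⟩ := exists_weight_eq_sum hp hq Y
  rw [hK (max K K') (le_max_left _ _), hK' (max K K') (le_max_right _ _)]
  simp only [h]

theorem layer_eq_zero_of_forall_lt (hp : 0 < p) (hq : 0 < q) (h : ∀ x ∈ X, x < q) (L : ℕ) :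
    layer p q L X = 0 := by
  have h' : ∀ K, ∀ x ∈ X, x < q * p ^ K := fun K x hx =>
    (h x hx).trans_le (Nat.le_mul_of_pos_right _ (pow_pos hp K))
  rw [layer, qcore_eq_self_of_forall_lt (Nat.mul_pos hq (pow_pos hp _)) (h' _),
    weight_eq_zero_of_lt (h' _)]

/-- The `q`-core of a diagram can be replaced by a smaller `q`-core, by removing boxes, in such a
way that the layers above do not grow and do not change modulo `p`. -/
theorem exists_qcore_eq_layer (hp : 2 ≤ p) (hq : 0 < q) (hD : qcore q D = D)
    (hdom : Dom D (qcore q X)) :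
    ∃ Y, Dom Y X ∧ qcore q Y = D ∧
      ∀ L, layer p q L Y ≤ layer p q L X ∧ layer p q L Y ≡ layer p q L X [MOD p] := by
  -- The excess `n` of the beads over `q` drops when `q` becomes `q * p`; once all beads are below
  -- `q`, all layers vanish.
  obtain ⟨n, hn⟩ : ∃ n, ∀ x ∈ X, x < q + n :=
    ⟨X.sup id + 1, fun x hx => by have : x ≤ X.sup id := le_sup (f := id) hx; omega⟩
  induction n generalizing q X D with
  | zero =>
    have hX := qcore_eq_self_of_forall_lt hq hn
    rw [hX] at hdom
    refine ⟨D, hdom, hD, fun L => ?_⟩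
    rw [layer_eq_zero_of_forall_lt (by omega) hq hn,
      layer_eq_zero_of_forall_lt (by omega) hq (hdom.lt_of_lt hn)]
    exact ⟨le_rfl, rfl⟩
  | succ n ih =>
    have hp0 : 0 < p := by omega
    have hqp : 0 < q * p := Nat.mul_pos hq hp0
    -- `Y` has as its `q`-weight the layer `0` of `X`. Passing to the `q * p`-core of `Y` lowers
    -- this by a multiple of `p`; that core is then installed in `X` by induction.
    obtain ⟨Y, hY1, hY2, hY3⟩ := exists_qcore_eq_weight_eq (X := qcore (q * p) X) hq hD
      (by rwa [qcore_qcore_mul hq hp0])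
    obtain ⟨Z, hZ1, hZ2, hZ3⟩ := ih (X := X) hqp (qcore_idem hqp Y) ((dom_qcore hqp Y).trans hY1)
      (fun x hx => by have := hn x hx; nlinarith)
    refine ⟨Z, hZ1, ?_, fun L => ?_⟩
    · rw [← qcore_qcore_mul hq hp0, hZ2, qcore_qcore_mul hq hp0, hY2]
    · cases L with
      | zero =>
        have := weight_eq_add hp0 hq Y
        rw [layer_zero, layer_zero, hZ2, ← hY3, this]
        exact ⟨by omega, by simp [Nat.ModEq]⟩
      | succ L => simpa only [layer_mul] using hZ3 L

/-- If all layers above the `q`-core are less than `p`, then they are kept when the `q`-core is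
replaced. -/
theorem exists_qcore_eq_layer_eq (hp : 2 ≤ p) (hq : 0 < q) (hD : qcore q D = D)
    (hdom : Dom D (qcore q X)) (hX : ∀ L, layer p q L X < p) :
    ∃ Y, Dom Y X ∧ qcore q Y = D ∧ ∀ L, layer p q L Y = layer p q L X := by
  obtain ⟨Y, h1, h2, h3⟩ := exists_qcore_eq_layer hp hq hD hdom
  exact ⟨Y, h1, h2, fun L => (h3 L).2.eq_of_lt_of_lt ((h3 L).1.trans_lt (hX L)) (hX L)⟩

/-- A diagram contains one with the same `q`-core, with layers less than `p`, and with `q`-weight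
at least the number whose base-`p` digits are the layers modulo `p`. -/
theorem exists_layer_lt (hp : 2 ≤ p) (hq : 0 < q) (X : Finset ℕ) :
    ∃ Y, Dom Y X ∧ qcore q Y = qcore q X ∧ (∀ L, layer p q L Y < p) ∧
      ∀ K, ∑ L ∈ range K, layer p q L X % p * p ^ L ≤ weight q Y := by
  obtain ⟨n, hn⟩ : ∃ n, ∀ x ∈ X, x < q + n :=
    ⟨X.sup id + 1, fun x hx => by have : x ≤ X.sup id := le_sup (f := id) hx; omega⟩
  induction n generalizing q with
  | zero =>
    have h0 := layer_eq_zero_of_forall_lt (p := p) (by omega) hq hn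
    refine ⟨X, Dom.refl X, rfl, fun L => by rw [h0]; omega, fun K => ?_⟩
    simp [h0]
  | succ n ih =>
    have hp0 : 0 < p := by omega
    have hqp : 0 < q * p := Nat.mul_pos hq hp0
    -- The higher layers are reduced first; the `q * p`-core, and with it layer `0`, stays the same.
    obtain ⟨Y, hY1, hY2, hY3, hY4⟩ := ih hqp (fun x hx => by have := hn x hx; nlinarith)
    have hqY : qcore q Y = qcore q X := qcore_eq_of_dvd hqp (Dvd.intro _ rfl) hY2
    suffices ∃ Z, Dom Z Y ∧ qcore q Z = qcore q Y ∧ (∀ L, layer p q L Z < p) ∧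
        weight (q * p) Z = weight (q * p) Y ∧ layer p q 0 X % p ≤ layer p q 0 Z by
      obtain ⟨Z, h1, h2, h3, h4, h5⟩ := this
      refine ⟨Z, h1.trans hY1, h2.trans hqY, h3, fun K => ?_⟩
      have h6 := weight_eq_add hp0 hq Z
      rw [← layer_zero, h4] at h6
      cases K with
      | zero => simp
      | succ K =>
        have h7 : ∑ L ∈ range K, layer p q (L + 1) X % p * p ^ (L + 1) =
            p * ∑ L ∈ range K, layer p (q * p) L X % p * p ^ L := by
          rw [mul_sum]
          refine sum_congr rfl fun L _ => ?_
          rw [layer_mul]; ring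
        have h8 := Nat.mul_le_mul_left p (hY4 K)
        rw [sum_range_succ', h7]
        simp only [pow_zero, mul_one]
        omega
    have hl0 : layer p q 0 Y = layer p q 0 X := by rw [layer_zero, layer_zero, hY2]
    by_cases hlt : layer p q 0 Y < p
    · refine ⟨Y, Dom.refl Y, rfl, fun L => ?_, rfl, hl0 ▸ Nat.mod_le _ _⟩
      cases L with
      | zero => exact hlt
      | succ L => rw [← layer_mul]; exact hY3 L
    · rw [layer_zero] at hlt
      -- Layer `0` is cut to the largest digit `p - 1`. A `q`-weight below `p` forces the `q *
      -- p`-weight to be zero, so `D` is again a `q * p`-core.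
      obtain ⟨D, hD1, hD2, hD3⟩ := exists_weight_eq hq (X := qcore (q * p) Y) (w := p - 1) (by omega)
      have hD4 : qcore (q * p) D = D := by
        refine qcore_eq_self_of_weight hqp ?_
        have := weight_eq_add hp0 hq D
        by_contra h0
        have : p * 1 ≤ p * weight (q * p) D := Nat.mul_le_mul_left _ (by omega)
        omega
      obtain ⟨Z, hZ1, hZ2, hZ3⟩ := exists_qcore_eq_layer_eq hp hqp hD4 hD1 hY3
      have hZ0 : layer p q 0 Z = p - 1 := by rw [layer_zero, hZ2, hD3]
      refine ⟨Z, hZ1, ?_, fun L => ?_, weight_congr hp hqp hZ3, ?_⟩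
      · rw [← qcore_qcore_mul hq hp0, hZ2, hD2, qcore_qcore_mul hq hp0]
      · cases L with
        | zero => omega
        | succ L => rw [← layer_mul, hZ3]; exact hY3 L
      · have := Nat.mod_lt (layer p q 0 X) hp0
        omega

end

/-! ### Removing one box from a diagram with empty core -/

theorem qcore_one (X : Finset ℕ) : qcore 1 X = range X.card := by
  ext x
  rw [mem_qcore one_pos, Nat.mod_one, runner_one, Nat.div_one, mem_range]

theorem weight_one_qcore_one (X : Finset ℕ) : weight 1 (qcore 1 X) = 0 :=
  weight_qcore_self one_pos X

theorem eq_range_of_weight_one {X : Finset ℕ} (h : weight 1 X = 0) : X = range X.card := by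
  rw [← qcore_one, qcore_eq_self_of_weight one_pos h]

theorem qcore_range {q : ℕ} (hq : 0 < q) (n : ℕ) : qcore q (range n) = range n :=
  qcore_eq_self_of_lt (by rwa [weight_one_range])

/-- Adding a bead at the bottom does not change the hooks. -/
theorem weight_insert_zero (q : ℕ) (X : Finset ℕ) :
    weight q (insert 0 (X.image (· + 1))) = weight q X := by
  unfold weight
  rw [sum_insert (by simp)]
  simp only [range_zero, filter_empty, card_empty, zero_add]
  rw [sum_image (by simp)]
  refine sum_congr rfl fun x _ => ?_
  symm
  apply card_bij (fun y _ => y + 1)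
  · intro y hy
    simp only [mem_filter, mem_range, mem_insert, mem_image] at hy ⊢
    refine ⟨by omega, ?_, by simpa using hy.2.2⟩
    rintro (h | ⟨z, hz, hzy⟩)
    · omega
    · exact hy.2.1 (by rwa [show y = z by omega])
  · intro y _ z _ h
    omega
  · intro y hy
    simp only [mem_filter, mem_range, mem_insert, mem_image, not_or] at hy ⊢
    refine ⟨y - 1, ⟨by omega, fun h => hy.2.1.2 ⟨y - 1, h, by omega⟩, ?_⟩, by omega⟩
    have := hy.2.2
    rwa [show x + 1 - y = x - (y - 1) by omega] at this

section
variable {p : ℕ} {C : Finset ℕ}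

/-- If all corners have contents divisible by `p`, then so is the weight. -/
theorem dvd_weight_pow (hp : 2 ≤ p) (H : ℕ) (h0 : weight 1 (qcore (p ^ (H + 1)) C) = 0)
    (h : ∀ b, b + 1 ∈ C → (b + 1) % p ≠ C.card % p → b ∈ C) : p ∣ weight (p ^ (H + 1)) C := by
  have hp0 : 0 < p := by omega
  have hcore : qcore p C = range C.card := by
    have h1 := eq_range_of_weight_one h0
    rw [card_qcore (pow_pos hp0 _)] at h1
    rw [pow_succ'] at h1
    rw [← qcore_qcore_mul hp0 (pow_pos hp0 H), h1, qcore_range hp0]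
  have hN : ∀ r < p, ∀ t, t < (runner p r C).card ↔ r + p * t < C.card := by
    intro r hr t
    rw [← mem_range (n := C.card), ← hcore, mem_qcore hp0, add_mul_mod_of_lt hr,
      add_mul_div_of_lt hr]
  -- A corner is a bead `b + 1` over a gap `b`, with content `b + 1 - C.card`. By hypothesis
  -- neighbouring runners agree except across the residue of `C.card`; going round cyclically, all
  -- `w r` are equal and their sum is `p * w 0`.
  let w := fun r => weight (p ^ H) (runner p r C)
  have hstep : ∀ r, r + 1 < p → r + 1 ≠ C.card % p → w (r + 1) = w r := by
    intro r hr hne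
    suffices runner p (r + 1) C = runner p r C by simp only [w, this]
    refine eq_of_subset_of_card_le (fun t ht => ?_) (le_of_eq (eq_of_forall_lt_iff fun t => ?_))
    · rw [mem_runner hr] at ht
      rw [mem_runner (by omega)]
      refine h _ (by convert ht using 1; ring) ?_
      rwa [show r + p * t + 1 = r + 1 + p * t by ring, add_mul_mod_of_lt hr]
    · rw [hN _ hr, hN _ (by omega)]
      refine ⟨fun hlt => ?_, fun hlt => by omega⟩
      by_contra hn
      apply hne
      rw [show C.card = r + 1 + p * t by omega, add_mul_mod_of_lt hr]
  have hchain : ∀ d s, s + d < p → (C.card % p ≤ s ∨ s + d < C.card % p) → w (s + d) = w s := by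
    intro d
    induction d with
    | zero => simp
    | succ d ih =>
      intro s hs hρ
      rw [← add_assoc, hstep (s + d) (by omega) (by omega), ih s (by omega) (by omega)]
  -- Across the wrap-around, runner `0` is runner `p - 1` raised by one with a bead added at the
  -- bottom.
  have hwrap : C.card % p ≠ 0 → w 0 = w (p - 1) := by
    intro hne
    have e : runner p 0 C = insert 0 ((runner p (p - 1) C).image (· + 1)) := by
      refine eq_of_subset_of_card_le (fun t ht => ?_) (le_of_eq ?_)
      · cases t with
        | zero => simp
        | succ t =>
          refine mem_insert_of_mem (mem_image_of_mem _ ?_)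
          rw [mem_runner hp0] at ht
          rw [mem_runner (by omega)]
          have e : 0 + p * (t + 1) = p - 1 + p * t + 1 := by rw [mul_add]; omega
          refine h _ (by rwa [← e]) ?_
          rw [← e]
          simpa using hne.symm
      · rw [card_insert_of_notMem (by simp), card_image_of_injective _ (add_left_injective 1)]
        refine eq_of_forall_lt_iff fun t => ?_
        rw [hN _ hp0]
        cases t with
        | zero =>
          have : C.card ≠ 0 := fun h => hne (by rw [h]; simp)
          rw [mul_zero]
          omega
        | succ t =>
          have e := mul_add p t 1
          rw [Nat.add_lt_add_iff_right, hN (p - 1) (by omega)]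
          refine ⟨fun hlt => ?_, fun hlt => by omega⟩
          by_contra hn
          apply hne
          rw [show C.card = p * (t + 1) by rw [mul_add]; omega]
          simp
    simp only [w]
    rw [e, weight_insert_zero]
  have hall : ∀ r < p, w r = w 0 := by
    intro r hr
    by_cases hρ : C.card % p = 0 ∨ r < C.card % p
    · have := hchain r 0 (by omega) (by omega)
      rwa [zero_add] at this
    · have hρp := Nat.mod_lt C.card hp0
      have h1 := hchain (r - C.card % p) (C.card % p) (by omega) (by omega)
      have h2 := hchain (p - 1 - C.card % p) (C.card % p) (by omega) (by omega)
      rw [show C.card % p + (r - C.card % p) = r by omega] at h1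
      rw [show C.card % p + (p - 1 - C.card % p) = p - 1 by omega] at h2
      rw [h1, hwrap (by omega), h2]
  rw [pow_succ', weight_runner hp0, sum_congr rfl (fun r hr => hall r (mem_range.mp hr))]
  simp

/-- One bead changes runner, so the empty core loses the top bead `a` of the runner of `b + 1` and
gains `a + q - 1`. The congruence condition makes the latter place free, and the new core is one
bead raised by `q - 1`. -/
theorem weight_one_qcore_corner {q b : ℕ} (hq : 2 ≤ q) (hC : qcore q C = range C.card)
    (hb : b + 1 ∈ C) (hb' : b ∉ C) (hne : (b + 1) % q ≠ C.card % q) :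
    weight 1 (qcore q (shiftBeads {b + 1} 1 C)) = q - 1 := by
  have hq0 : 0 < q := by omega
  have hs : Shiftable {b + 1} 1 C := ⟨by simpa using hb, by simpa using hb'⟩
  have hnon : ({x ∈ range C.card | x % q = (b + 1) % q}).Nonempty := by
    refine ⟨(b + 1) % q, mem_filter.mpr ⟨?_, Nat.mod_mod _ _⟩⟩
    rw [← hC, mem_qcore hq0, Nat.mod_mod, Nat.div_eq_of_lt (Nat.mod_lt _ hq0), card_pos]
    exact ⟨_, (div_mem_runner hq0).mpr hb⟩
  obtain ⟨a, ha, hmax⟩ := exists_max_image _ id hnon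
  simp only [mem_filter, mem_range, id] at ha hmax
  have han : C.card ≤ a + q - 1 := by
    by_contra hlt
    rcases (show a + q < C.card ∨ a + q = C.card by omega) with h | h
    · have := hmax (a + q) ⟨h, by simpa using ha.2⟩
      omega
    · apply hne
      rw [← ha.2, ← h]; simp
  let E := insert (a + q - 1) ((range C.card).erase a)
  have hsE : Shiftable {a + q - 1} (q - 1) E := by
    refine ⟨by simp [E], ?_⟩
    intro x hx
    rw [mem_singleton] at hx
    subst hx
    refine ⟨by omega, ?_⟩
    rw [show a + q - 1 - (q - 1) = a by omega]
    simp only [E, mem_insert, mem_erase, mem_range, not_or]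
    exact ⟨by omega, by tauto⟩
  have hE : shiftBeads {a + q - 1} (q - 1) E = range C.card := by
    ext x
    simp only [mem_shiftBeads, mem_singleton, exists_eq_left, E, mem_insert, mem_erase, mem_range]
    omega
  have hcE : qcore q E = E := by
    refine qcore_eq_self hq0 fun x hx hqx => ?_
    simp only [E, mem_insert, mem_erase, mem_range] at hx ⊢
    omega
  have hDE : qcore q (shiftBeads {b + 1} 1 C) = qcore q E := by
    refine qcore_congr hq0 fun r hr => ?_
    have h1 := card_runner_shiftBeads hs q r
    have h2 := card_runner_shiftBeads hsE q r
    rw [hE, ← hC, runner_qcore hr, card_range] at h2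
    have e1 : a + q - 1 - (q - 1) = a := by omega
    have e2 : (a + q - 1) % q = b % q := by
      have : a + q - 1 + 1 ≡ b + 1 [MOD q] := by
        rw [Nat.sub_add_cancel (by omega)]
        simpa [Nat.ModEq] using ha.2
      exact Nat.ModEq.add_right_cancel' 1 this
    simp only [filter_singleton, Nat.add_sub_cancel, e1, e2, ha.2, apply_ite card, card_singleton,
      card_empty] at h1 h2
    omega
  have h1 := weight_one_shiftBeads hsE
  rw [hE, weight_one_range, card_singleton] at h1
  rw [hDE, hcE]
  omega

/-- If the `p ^ H`-core is empty and the `p ^ H`-weight is not divisible by `p`, then a box can be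
removed in such a way that the `p ^ L`-cores become as large as possible for `L ≤ H`. -/
theorem exists_box_removal (hp : 2 ≤ p) (H : ℕ) (h0 : weight 1 (qcore (p ^ H) C) = 0)
    (hw : ¬ p ∣ weight (p ^ H) C) :
    ∃ D, Dom D C ∧ weight 1 D + 1 = weight 1 C ∧ ∀ L ≤ H, weight 1 (qcore (p ^ L) D) < p ^ L := by
  have hp0 : 0 < p := by omega
  have hzero : ∀ D, weight 1 (qcore (p ^ 0) D) < p ^ 0 := by
    intro D
    rw [pow_zero, weight_one_qcore_one]
    exact one_pos
  cases H with
  | zero =>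
    rw [pow_zero] at hw
    obtain ⟨D, h1, -, h3⟩ := exists_hook_removal one_pos (X := C)
      (Nat.pos_of_ne_zero fun h => hw (h ▸ dvd_zero p))
    refine ⟨D, h1, h3, fun L hL => ?_⟩
    obtain rfl : L = 0 := by omega
    exact hzero D
  | succ H =>
    -- A content not divisible by `p` is not divisible by any `p ^ (L + 1)`, so one corner serves
    -- all levels.
    have : ∃ b, b + 1 ∈ C ∧ (b + 1) % p ≠ C.card % p ∧ b ∉ C := by
      by_contra! hn
      exact hw (dvd_weight_pow hp H h0 hn)
    obtain ⟨b, hb, hbp, hb'⟩ := this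
    have hs : Shiftable {b + 1} 1 C := ⟨by simpa using hb, by simpa using hb'⟩
    refine ⟨_, dom_shiftBeads hs, by simpa using weight_one_shiftBeads hs, fun L hL => ?_⟩
    cases L with
    | zero => exact hzero _
    | succ L =>
      have hL0 : 0 < p ^ (L + 1) := pow_pos hp0 _
      have h2 : 2 ≤ p ^ (L + 1) := hp.trans (Nat.le_self_pow (by omega) p)
      rw [weight_one_qcore_corner h2 ?_ hb hb']
      · omega
      · intro h
        have hd : p ∣ p ^ (L + 1) := dvd_pow_self p (by omega)
        exact hbp (Nat.ModEq.of_dvd hd h)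
      · have h1 := eq_range_of_weight_one h0
        rw [card_qcore (pow_pos hp0 _)] at h1
        obtain ⟨d, hd⟩ := pow_dvd_pow p hL
        have hd0 : 0 < d := by
          rcases Nat.eq_zero_or_pos d with rfl | h
          · rw [mul_zero] at hd
            have := pow_pos hp0 (H + 1)
            omega
          · exact h
        rw [hd] at h1
        rw [← qcore_qcore_mul hL0 hd0, h1, qcore_range hL0]

end

/-! ### Construction of full diagrams -/

/-- All the `p ^ L`-cores of `X` are as small as the sizes modulo `p ^ L` permit. -/
def Full (p : ℕ) (X : Finset ℕ) : Prop := ∀ L, weight 1 (qcore (p ^ L) X) < p ^ L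

theorem sum_mul_pow_lt {p : ℕ} (K : ℕ) {a : ℕ → ℕ} (h : ∀ L, a L < p) :
    ∑ L ∈ range K, a L * p ^ L < p ^ K := by
  induction K with
  | zero => simp
  | succ K ih =>
    rw [sum_range_succ, pow_succ]
    have := Nat.mul_le_mul_right (p ^ K) (Nat.succ_le_of_lt (h K))
    rw [Nat.succ_mul] at this
    rw [mul_comm (p ^ K) p]
    omega

section
variable {p : ℕ} {X Y : Finset ℕ}

/-- The value `p + 1` is at least `p` and not divisible by `p`: from size `p ^ N * (p + 1)` a good
box can be removed, which leaves a core of size `p ^ N - 1` and weight `p`. One more `p ^ N`-hook is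
then removed. -/
theorem exists_full_pow_sub_one (hp : 2 ≤ p) {N : ℕ} (hN : p + 1 ≤ weight (p ^ N) X) :
    ∃ D, Dom D X ∧ weight 1 D = p ^ (N + 1) - 1 ∧
      ∀ L ≤ N, weight 1 (qcore (p ^ L) D) < p ^ L := by
  have hp0 : 0 < p := by omega
  have hM : 0 < p ^ N := pow_pos hp0 N
  obtain ⟨Z₁, h1, h2, h3⟩ := exists_qcore_eq_weight_eq (X := X) hM
    (qcore_range hM X.card) (by
      have := dom_qcore one_pos (qcore (p ^ N) X)
      rwa [qcore_one, card_qcore hM] at this)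
  obtain ⟨Z₂, h4, h5, h6⟩ := exists_weight_eq hM (X := Z₁) (w := p + 1) (by omega)
  have h7 : weight 1 (qcore (p ^ N) Z₂) = 0 := by rw [h5, h2, weight_one_range]
  obtain ⟨D₁, h8, h9, h10⟩ := exists_box_removal hp N h7 (by
    rw [h6]
    intro h
    have := Nat.le_of_dvd one_pos ((Nat.dvd_add_right (dvd_refl p)).mp h)
    omega)
  have e1 := weight_one_eq hM Z₂
  have e2 := weight_one_eq hM D₁
  rw [h6, h7, mul_add, mul_one] at e1
  have h11 := h10 N le_rfl
  have h12 : weight (p ^ N) D₁ = p := by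
    apply le_antisymm
    · by_contra hlt
      have := Nat.mul_le_mul_left (p ^ N) (not_le.mp hlt)
      rw [Nat.succ_eq_add_one, mul_add, mul_one] at this
      omega
    · by_contra hlt
      have := Nat.mul_le_mul_left (p ^ N) (not_le.mp hlt)
      rw [Nat.succ_eq_add_one, mul_add, mul_one] at this
      omega
  rw [h12] at e2
  obtain ⟨D₂, h13, h14, h15⟩ := exists_weight_eq hM (X := D₁) (w := p - 1) (by omega)
  refine ⟨D₂, (h13.trans h8).trans (h4.trans h1), ?_, fun L hL => ?_⟩
  · have e3 := weight_one_eq hM D₂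
    rw [h14, h15, Nat.mul_sub, mul_one] at e3
    have : p ^ N ≤ p ^ N * p := Nat.le_mul_of_pos_right _ hp0
    rw [pow_succ]
    omega
  · rw [qcore_eq_of_dvd hM (pow_dvd_pow p hL) h14]
    exact h10 L hL

/-- If the `N`th row of the `p`-core tower has more than `p` boxes, then a full diagram can be
reached whose lowest `N + 1` digits are `p - 1` and whose size is at least the given number. -/
theorem exists_full (hp : 2 ≤ p) {N : ℕ}
    (hN : p + 1 ≤ weight (p ^ N) (qcore (p ^ (N + 1)) X)) :
    ∃ Y, Dom Y X ∧ Full p Y ∧ ∀ K, p ^ (N + 1) - 1 +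
      p ^ (N + 1) * ∑ L ∈ range K, layer p (p ^ (N + 1)) L X % p * p ^ L ≤ weight 1 Y := by
  have hp0 : 0 < p := by omega
  have hq : 0 < p ^ (N + 1) := pow_pos hp0 _
  obtain ⟨D, hD1, hD2, hD3⟩ := exists_full_pow_sub_one hp hN
  have hD : qcore (p ^ (N + 1)) D = D := qcore_eq_self_of_lt (by omega)
  obtain ⟨Z, hZ1, hZ2, hZ3, hZ4⟩ := exists_layer_lt hp hq X
  obtain ⟨Y, hY1, hY2, hY3⟩ := exists_qcore_eq_layer_eq hp hq hD (by rwa [hZ2]) hZ3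
  refine ⟨Y, hY1.trans hZ1, fun L => ?_, fun K => ?_⟩
  · rcases le_or_gt L N with hL | hL
    · rw [qcore_eq_of_dvd hq (pow_dvd_pow p (by omega)) (hY2.trans hD.symm)]
      exact hD3 L hL
    -- Above row `N` the core has size `p ^ (N + 1) - 1` plus `p ^ (N + 1)` times a number with `K`
    -- base-`p` digits.
    · obtain ⟨K, rfl⟩ := Nat.exists_eq_add_of_le (Nat.succ_le_of_lt hL)
      have h1 := weight_one_qcore_pow hp0 hq K Y
      have h2 := sum_mul_pow_lt (p := p) K (a := fun L => layer p (p ^ (N + 1)) L Y)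
        (fun L => by rw [hY3]; exact hZ3 L)
      have h3 := Nat.mul_le_mul_left (p ^ (N + 1)) (Nat.succ_le_of_lt h2)
      rw [Nat.succ_eq_add_one, mul_add, mul_one] at h3
      rw [Nat.succ_eq_add_one, pow_add p (N + 1) K, h1, hY2, hD2]
      omega
  · rw [weight_one_eq hq Y, hY2, hD2, weight_congr hp hq hY3]
    exact Nat.add_le_add_left (Nat.mul_le_mul_left _ (hZ4 K)) _

end

/-! ### Box removals and lowerings -/

/-- `X'` arises from `X` by moving one bead down by one. -/
def BoxRemoval (X X' : Finset ℕ) : Prop := ∃ b, b + 1 ∈ X ∧ b ∉ X ∧ X' = shiftBeads {b + 1} 1 X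

section
variable {X Y : Finset ℕ}

theorem shiftable_corner {b : ℕ} (hb : b + 1 ∈ X) (hb' : b ∉ X) : Shiftable {b + 1} 1 X :=
  ⟨by simpa using hb, by simpa using hb'⟩

/-- From the highest bead `z` of `X \ Y`, follow the run of beads of `X` down to the first gap `b`.
The strict inequality at `z` persists to `b + 1`, the only threshold affected by moving `b + 1`. -/
theorem Dom.exists_corner (h : Dom Y X) (hne : Y ≠ X) :
    ∃ b, b + 1 ∈ X ∧ b ∉ X ∧ Dom Y (shiftBeads {b + 1} 1 X) := by
  obtain ⟨b₀, δ, hδ, ha, hb, -⟩ := exists_minimal_gap h hne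
  obtain ⟨z, hz, hzmax⟩ := exists_max_image (X \ Y) id ⟨_, ha⟩
  have hY : ∀ d ≤ z, (∀ y, z - d ≤ y → y < z → y ∈ X) → above (z - d) Y < above (z - d) X := by
    intro d hd hX
    refine above_lt_of_mem_sdiff h hz d hd fun y hy hyz => ?_
    by_contra hlt
    rcases (not_lt.mp hlt).lt_or_eq with h1 | h1
    · exact (mem_sdiff.mp hy).2 (hX y hyz h1)
    · exact (mem_sdiff.mp hy).2 (h1 ▸ (mem_sdiff.mp hz).1)
  have hnon : ({y ∈ range z | y ∉ X}).Nonempty := by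
    by_contra hn
    rw [not_nonempty_iff_eq_empty, filter_eq_empty_iff] at hn
    have := hY z le_rfl (fun y _ hyz => not_not.mp (hn (mem_range.mpr hyz)))
    rw [Nat.sub_self, above_zero, above_zero, h.1] at this
    omega
  obtain ⟨b, hb1, hbmax⟩ := exists_max_image _ id hnon
  simp only [mem_filter, mem_range, id] at hb1 hbmax
  have hmem : ∀ y, b < y → y < z → y ∈ X := by
    intro y hby hyz
    by_contra hn
    have := hbmax y ⟨hyz, hn⟩
    omega
  have hb2 : b + 1 ∈ X := by
    rcases (show b + 1 < z ∨ b + 1 = z by omega) with h1 | h1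
    · exact hmem _ (by omega) h1
    · exact h1 ▸ (mem_sdiff.mp hz).1
  have hs := shiftable_corner hb2 hb1.2
  refine ⟨b, hb2, hb1.2, (card_shiftBeads hs).symm ▸ h.1, fun w => ?_⟩
  have h1 := above_shiftBeads hs w
  have h2 := h.2 w
  rw [filter_singleton] at h1
  split_ifs at h1 with h3
  · obtain rfl : w = b + 1 := by omega
    have := hY (z - (b + 1)) (by omega) (fun y hy hyz => hmem y (by omega) hyz)
    rw [show z - (z - (b + 1)) = b + 1 by omega] at this
    rw [card_singleton] at h1
    omega
  · rw [card_empty] at h1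
    omega

theorem Dom.reflTransGen (h : Dom Y X) : Relation.ReflTransGen BoxRemoval X Y := by
  induction hn : weight 1 X using Nat.strong_induction_on generalizing X with
  | _ n ih =>
    by_cases hne : Y = X
    · rw [hne]
    · obtain ⟨b, h1, h2, h3⟩ := h.exists_corner hne
      have := weight_one_shiftBeads (shiftable_corner h1 h2)
      exact (ih _ (by simp at this; omega) h3 rfl).head ⟨b, h1, h2, rfl⟩

/-- `Y` arises from `X` by moving beads down by multiples of `μ`, all at the same time. -/
def Lowering (μ : ℕ) (X Y : Finset ℕ) : Prop :=
  ∃ g : ℕ → ℕ, Set.InjOn g X ∧ X.image g = Y ∧ ∀ x ∈ X, g x ≤ x ∧ μ ∣ x - g x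

theorem Lowering.refl (μ : ℕ) (X : Finset ℕ) : Lowering μ X X :=
  ⟨id, Set.injOn_id _, image_id, fun x _ => ⟨le_rfl, by simp⟩⟩

theorem Lowering.trans {μ : ℕ} {Z : Finset ℕ} (h : Lowering μ X Y) (h' : Lowering μ Y Z) :
    Lowering μ X Z := by
  obtain ⟨g, hg, rfl, hle⟩ := h
  obtain ⟨g', hg', rfl, hle'⟩ := h'
  have hmaps : Set.MapsTo g X (X.image g) := fun x hx => by
    rw [coe_image]; exact Set.mem_image_of_mem g hx
  refine ⟨g' ∘ g, hg'.comp hg hmaps, image_image.symm, fun x hx => ?_⟩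
  have h1 := hle x hx
  have h2 := hle' (g x) (mem_image_of_mem g hx)
  refine ⟨h2.1.trans h1.1, ?_⟩
  have e : x - g' (g x) = (x - g x) + (g x - g' (g x)) := by omega
  rw [Function.comp_apply, e]
  exact dvd_add h1.2 h2.2

theorem BoxRemoval.exists_map (h : BoxRemoval X Y) :
    ∃ g : ℕ → ℕ, Set.InjOn g X ∧ X.image g = Y ∧ (∀ x ∈ X, g x ≤ x) ∧ #{x ∈ X | x ≠ g x} ≤ 1 := by
  obtain ⟨b, h1, h2, rfl⟩ := h
  refine ⟨fun x => if x = b + 1 then b else x, ?_, ?_, fun x _ => ?_, ?_⟩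
  · intro x hx y hy hxy
    simp only at hxy
    split_ifs at hxy with h3 h4 h4
    · omega
    · exact absurd (hxy ▸ hy) h2
    · exact absurd (hxy ▸ hx) h2
    · exact hxy
  · ext y
    simp only [mem_image, mem_shiftBeads, mem_singleton, exists_eq_left, Nat.add_sub_cancel]
    constructor
    · rintro ⟨x, hx, rfl⟩
      split_ifs with h3
      · exact Or.inr rfl
      · exact Or.inl ⟨hx, h3⟩
    · rintro (⟨h3, h4⟩ | rfl)
      · exact ⟨y, h3, if_neg h4⟩
      · exact ⟨b + 1, h1, if_pos rfl⟩
  · simp only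
    split_ifs <;> omega
  · refine (card_le_card fun x hx => ?_).trans (card_singleton (b + 1)).le
    simp only [mem_filter] at hx
    by_contra hne
    rw [mem_singleton] at hne
    exact hx.2 (if_neg hne).symm

theorem BoxRemoval.lowering (h : BoxRemoval X Y) : Lowering 1 X Y := by
  obtain ⟨g, h1, h2, h3, -⟩ := h.exists_map
  exact ⟨g, h1, h2, fun x hx => ⟨h3 x hx, one_dvd _⟩⟩

theorem BoxRemoval.weight (h : BoxRemoval X Y) : weight 1 Y + 1 = weight 1 X := by
  obtain ⟨b, h1, h2, rfl⟩ := h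
  simpa using weight_one_shiftBeads (shiftable_corner h1 h2)

theorem Dom.lowering (h : Dom Y X) : Lowering 1 X Y := by
  have h' := h.reflTransGen
  clear h
  induction h' with
  | refl => exact Lowering.refl 1 X
  | tail _ h ih => exact ih.trans h.lowering

/-- The `R`th of the `μ` runners of `X` is replaced by `Y`. -/
def setRunner (μ R : ℕ) (X Y : Finset ℕ) : Finset ℕ :=
  {x ∈ X | x % μ ≠ R} ∪ Y.image fun t => R + μ * t

theorem runner_setRunner {μ R : ℕ} (hR : R < μ) {r : ℕ} (hr : r < μ) :
    runner μ r (setRunner μ R X Y) = if r = R then Y else runner μ r X := by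
  have hμ : 0 < μ := by omega
  ext t
  rw [mem_runner hr]
  simp only [setRunner, mem_union, mem_filter, mem_image, add_mul_mod_of_lt hr]
  split_ifs with h
  · subst h
    constructor
    · rintro (⟨-, h⟩ | ⟨u, hu, h⟩)
      · exact absurd rfl h
      · have : u = t := by simpa [hμ.ne'] using h
        rwa [← this]
    · exact fun h => Or.inr ⟨t, h, rfl⟩
  · rw [mem_runner hr]
    constructor
    · rintro (⟨h1, -⟩ | ⟨u, hu, h1⟩)
      · exact h1
      · have := congrArg (· % μ) h1
        simp only [add_mul_mod_of_lt hr, add_mul_mod_of_lt hR] at this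
        exact absurd this.symm h
    · exact fun h1 => Or.inl ⟨h1, h⟩

theorem lowering_setRunner {μ R : ℕ} (hR : R < μ) (h : Lowering 1 (runner μ R X) Y) :
    Lowering μ X (setRunner μ R X Y) := by
  have hμ : 0 < μ := by omega
  obtain ⟨g, hg, rfl, hle⟩ := h
  have hrun : ∀ x ∈ X, x % μ = R → x / μ ∈ runner μ R X := by
    rintro x hx rfl
    exact (div_mem_runner hμ).mpr hx
  refine ⟨fun x => if x % μ = R then R + μ * g (x / μ) else x, ?_, ?_, fun x hx => ?_⟩
  · intro x hx y hy hxy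
    simp only at hxy
    split_ifs at hxy with h1 h2 h2
    · have h3 : g (x / μ) = g (y / μ) := by simpa [hμ.ne'] using hxy
      have h4 := hg (hrun x hx h1) (hrun y hy h2) h3
      rw [← Nat.mod_add_div x μ, ← Nat.mod_add_div y μ, h1, h2, h4]
    · exact absurd (by rw [← hxy, add_mul_mod_of_lt hR]) h2
    · exact absurd (by rw [hxy, add_mul_mod_of_lt hR]) h1
    · exact hxy
  · ext y
    simp only [setRunner, mem_image, mem_union, mem_filter, exists_exists_and_eq_and]
    constructor
    · rintro ⟨x, hx, rfl⟩
      split_ifs with h1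
      · exact Or.inr ⟨x / μ, hrun x hx h1, rfl⟩
      · exact Or.inl ⟨hx, h1⟩
    · rintro (⟨h1, h2⟩ | ⟨t, ht, rfl⟩)
      · exact ⟨y, h1, if_neg h2⟩
      · refine ⟨R + μ * t, (mem_runner hR).mp ht, ?_⟩
        rw [if_pos (add_mul_mod_of_lt hR), add_mul_div_of_lt hR]
  · simp only
    split_ifs with h1
    · have h2 := (hle _ (hrun x hx h1)).1
      have h3 := Nat.mod_add_div x μ
      have h4 := Nat.mul_le_mul_left μ h2
      refine ⟨by omega, ⟨x / μ - g (x / μ), ?_⟩⟩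
      rw [Nat.mul_sub]
      omega
    · simp

end

/-! ### Lowering full diagrams along runners -/

/-- The total size of the `p ^ L`-cores of the runners of the abacus of `X` with `μ` runners. -/
def coreTotal (p μ L : ℕ) (X : Finset ℕ) : ℕ :=
  ∑ r ∈ range μ, weight 1 (qcore (p ^ L) (runner μ r X))

section
variable {p μ : ℕ} {X Y : Finset ℕ}

theorem weight_one_qcore_mul {s : ℕ} (hμ : 0 < μ) (hs : 0 < s) (X : Finset ℕ) :
    weight 1 (qcore (μ * s) X) =
      weight 1 (qcore μ X) + μ * ∑ r ∈ range μ, weight 1 (qcore s (runner μ r X)) := by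
  rw [weight_one_eq hμ, qcore_qcore_mul hμ hs, weight_eq_sum hμ]
  congr 2
  exact sum_congr rfl fun r hr => by rw [runner_qcore_mul hs (mem_range.mp hr)]

/-- The `p ^ (M + L)`-core has at least `p ^ M` times this total many boxes. -/
theorem Full.coreTotal_lt (hp : 0 < p) (hX : Full p X) (M L : ℕ) :
    coreTotal p (p ^ M) L X < p ^ L := by
  have h1 := weight_one_qcore_mul (pow_pos hp M) (pow_pos hp L) X
  have h2 := hX (M + L)
  rw [pow_add, h1] at h2
  exact Nat.lt_of_mul_lt_mul_left ((Nat.le_add_left _ _).trans_lt h2)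

theorem coreTotal_zero : coreTotal p μ 0 X = 0 := by
  simp [coreTotal, weight_one_qcore_one]

theorem runner_lt (hμ : 0 < μ) {b r t : ℕ} (hr : r < μ) (hX : ∀ x ∈ X, x < b)
    (ht : t ∈ runner μ r X) : t < b := by
  have h1 := hX _ ((mem_runner hr).mp ht)
  have := Nat.le_mul_of_pos_left t hμ
  omega

theorem exists_coreTotal_pos (hp : 2 ≤ p) (hμ : 0 < μ) (h : 0 < weight μ X) :
    ∃ L, 0 < coreTotal p μ L X := by
  obtain ⟨K, hK⟩ := exists_forall_lt_mul_pow hp one_pos X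
  refine ⟨K, ?_⟩
  rw [weight_eq_sum hμ] at h
  refine h.trans_le (sum_le_sum fun r hr => ?_)
  rw [qcore_eq_self_of_forall_lt (pow_pos (by omega) K)]
  intro t ht
  refine runner_lt hμ (mem_range.mp hr) (fun x hx => ?_) ht
  simpa using hK K le_rfl x hx

theorem sum_runner_setRunner {R : ℕ} (hR : R < μ) (F : Finset ℕ → ℕ) :
    ∑ r ∈ range μ, F (runner μ r (setRunner μ R X Y)) + F (runner μ R X) =
      ∑ r ∈ range μ, F (runner μ r X) + F Y := by
  rw [← add_sum_erase _ _ (mem_range.mpr hR),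
    ← add_sum_erase _ (fun r => F (runner μ r X)) (mem_range.mpr hR), runner_setRunner hR hR,
    if_pos rfl]
  have : ∑ r ∈ (range μ).erase R, F (runner μ r (setRunner μ R X Y)) =
      ∑ r ∈ (range μ).erase R, F (runner μ r X) := by
    refine sum_congr rfl fun r hr => ?_
    rw [mem_erase, mem_range] at hr
    rw [runner_setRunner hR hr.2, if_neg hr.1]
  omega

/-- One box can be removed from one runner in such a way that the total sizes of the cores of the
runners remain as small as possible. -/
theorem exists_runner_removal (hp : 2 ≤ p) (hμ : 0 < μ) (hX : ∀ L, coreTotal p μ L X < p ^ L)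
    (hw : 0 < weight μ X) :
    ∃ R < μ, ∃ Y, Dom Y (runner μ R X) ∧ weight 1 Y + 1 = weight 1 (runner μ R X) ∧
      ∀ L, coreTotal p μ L (setRunner μ R X Y) < p ^ L := by
  have hp0 : 0 < p := by omega
  have hex := exists_coreTotal_pos hp hμ hw
  -- `H + 1` is the least level at which some runner has a nonempty core; level `0` is excluded
  -- since `1`-cores are empty.
  obtain ⟨H, hH⟩ : ∃ H, Nat.find hex = H + 1 := by
    refine Nat.exists_eq_succ_of_ne_zero fun h => ?_
    have := Nat.find_spec hex
    rw [h, coreTotal_zero] at this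
    omega
  have hpos : 0 < coreTotal p μ (H + 1) X := hH ▸ Nat.find_spec hex
  have hzero : ∀ L ≤ H, ∀ r < μ, weight 1 (qcore (p ^ L) (runner μ r X)) = 0 := by
    intro L hL r hr
    have h1 : coreTotal p μ L X = 0 := Nat.eq_zero_of_not_pos (Nat.find_min hex (by omega))
    exact sum_eq_zero_iff.mp h1 r (mem_range.mpr hr)
  obtain ⟨R, hR, hRpos⟩ : ∃ R ∈ range μ, weight 1 (qcore (p ^ (H + 1)) (runner μ R X)) ≠ 0 := by
    by_contra! h
    rw [coreTotal, sum_eq_zero h] at hpos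
    omega
  rw [mem_range] at hR
  set F := runner μ R X with hF
  have hFle : ∀ L, weight 1 (qcore (p ^ L) F) ≤ coreTotal p μ L X := fun L =>
    single_le_sum (f := fun r => weight 1 (qcore (p ^ L) (runner μ r X)))
      (fun _ _ => Nat.zero_le _) (mem_range.mpr hR)
  have hQ : 0 < p ^ H := pow_pos hp0 H
  have hQp : 0 < p ^ (H + 1) := pow_pos hp0 _
  have hcore : qcore (p ^ H) (qcore (p ^ (H + 1)) F) = qcore (p ^ H) F := by
    rw [pow_succ, qcore_qcore_mul hQ hp0]
  have hsize := weight_one_eq hQ (qcore (p ^ (H + 1)) F)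
  rw [hcore, hzero H le_rfl R hR, zero_add] at hsize
  have hlt := (hFle (H + 1)).trans_lt (hX (H + 1))
  -- The `p ^ H`-weight of this core lies strictly between `0` and `p`, so `p` does not divide it.
  obtain ⟨D, hD1, hD2, hD3⟩ := exists_box_removal (C := qcore (p ^ (H + 1)) F) hp H
    (by rw [hcore, hzero H le_rfl R hR]) (by
      rw [hsize] at hlt
      have h1 := Nat.lt_of_mul_lt_mul_left (hlt.trans_eq (pow_succ p H))
      intro h2
      have h3 : weight (p ^ H) (qcore (p ^ (H + 1)) F) ≠ 0 := fun h => hRpos (by rw [hsize, h, mul_zero])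
      have := Nat.le_of_dvd (Nat.pos_of_ne_zero h3) h2
      omega)
  have hDcore : qcore (p ^ (H + 1)) D = D := qcore_eq_self_of_lt (by omega)
  have hlayer : ∀ L, layer p (p ^ (H + 1)) L F < p := by
    intro L
    have h1 := weight_one_qcore_pow hp0 hQp (L + 1) F
    have h2 := (hFle (H + 1 + (L + 1))).trans_lt (hX _)
    rw [pow_add p (H + 1), h1] at h2
    have h3 := Nat.lt_of_mul_lt_mul_left ((Nat.le_add_left _ _).trans_lt h2)
    rw [sum_range_succ] at h3
    exact Nat.lt_of_mul_lt_mul_right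
      (((Nat.le_add_left _ _).trans_lt h3).trans_eq (pow_succ' p L))
  obtain ⟨Y, hY1, hY2, hY3⟩ := exists_qcore_eq_layer_eq hp hQp hDcore hD1 hlayer
  refine ⟨R, hR, Y, hY1, ?_, fun L => ?_⟩
  · rw [weight_one_eq hQp Y, weight_one_eq hQp F, hY2, weight_congr hp hQp hY3]
    omega
  · have h1 := sum_runner_setRunner (X := X) (Y := Y) hR (fun Z => weight 1 (qcore (p ^ L) Z))
    -- Up to level `H` only runner `R` contributes after the change; above it the total drops by
    -- exactly one.
    rcases le_or_gt L H with hL | hL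
    · have h2 : ∑ r ∈ range μ, weight 1 (qcore (p ^ L) (runner μ r X)) = 0 :=
        sum_eq_zero fun r hr => hzero L hL r (mem_range.mp hr)
      rw [h2, qcore_eq_of_dvd hQp (pow_dvd_pow p (by omega)) (hY2.trans hDcore.symm)] at h1
      have := hD3 L hL
      unfold coreTotal
      omega
    · obtain ⟨K, rfl⟩ := Nat.exists_eq_add_of_le (Nat.succ_le_of_lt hL)
      have h2 := weight_one_qcore_pow hp0 hQp K Y
      have h3 := weight_one_qcore_pow hp0 hQp K F
      simp only [hY3] at h2
      rw [hY2] at h2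
      rw [Nat.succ_eq_add_one] at h1 ⊢
      have h4 := hX (H + 1 + K)
      unfold coreTotal at h4 ⊢
      rw [← hF] at h1
      rw [← pow_add] at h2 h3
      omega

/-- One box on one runner is worth `p ^ M` boxes of `X`. Levels up to `M` depend only on the
unchanged `p ^ M`-core; the higher ones are bounded by `coreTotal`. -/
theorem Full.exists_lowering_one (hp : 2 ≤ p) (hX : Full p X) (M : ℕ) (hw : 0 < weight (p ^ M) X) :
    ∃ Y, Lowering (p ^ M) X Y ∧ Full p Y ∧ qcore (p ^ M) Y = qcore (p ^ M) X ∧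
      weight (p ^ M) Y + 1 = weight (p ^ M) X := by
  have hp0 : 0 < p := by omega
  have hμ : 0 < p ^ M := pow_pos hp0 M
  obtain ⟨R, hR, Y, hY1, hY2, hY3⟩ := exists_runner_removal hp hμ (hX.coreTotal_lt hp0 M) hw
  have hcore : qcore (p ^ M) (setRunner (p ^ M) R X Y) = qcore (p ^ M) X := by
    refine qcore_congr hμ fun r hr => ?_
    rw [runner_setRunner hR hr]
    split_ifs with h
    · rw [h, hY1.1]
    · rfl
  refine ⟨setRunner (p ^ M) R X Y, lowering_setRunner hR hY1.lowering, fun L => ?_, hcore, ?_⟩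
  · rcases le_or_gt L M with hL | hL
    · rw [qcore_eq_of_dvd hμ (pow_dvd_pow p hL) hcore]
      exact hX L
    · obtain ⟨K, rfl⟩ := Nat.exists_eq_add_of_le hL.le
      have h1 := Nat.mul_le_mul_left (p ^ M) (Nat.succ_le_of_lt (hY3 K))
      have h2 := hX M
      rw [pow_add, weight_one_qcore_mul hμ (pow_pos hp0 K), hcore]
      rw [Nat.succ_eq_add_one, mul_add, mul_one, coreTotal] at h1
      omega
  · have h1 := sum_runner_setRunner (X := X) (Y := Y) hR (weight 1)
    rw [weight_eq_sum hμ, weight_eq_sum hμ X]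
    omega

theorem Full.exists_lowering (hp : 2 ≤ p) (hX : Full p X) (M : ℕ) {j : ℕ}
    (hj : p ^ M * j ≤ weight 1 X) :
    ∃ Y, Lowering (p ^ M) X Y ∧ Full p Y ∧ weight 1 Y + p ^ M * j = weight 1 X := by
  have hμ : 0 < p ^ M := pow_pos (by omega) M
  -- Fullness at level `M` leaves fewer than `p ^ M` boxes outside the `p ^ M`-weight.
  have hle : j ≤ weight (p ^ M) X := by
    rw [weight_one_eq hμ] at hj
    have h1 := hX M
    have h2 : p ^ M * j < p ^ M * (weight (p ^ M) X + 1) := by rw [mul_add]; omega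
    have := Nat.lt_of_mul_lt_mul_left h2
    omega
  suffices ∃ Y, Lowering (p ^ M) X Y ∧ Full p Y ∧ qcore (p ^ M) Y = qcore (p ^ M) X ∧
      weight (p ^ M) Y + j = weight (p ^ M) X by
    obtain ⟨Y, h1, h2, h3, h4⟩ := this
    refine ⟨Y, h1, h2, ?_⟩
    rw [weight_one_eq hμ, weight_one_eq hμ X, h3, ← h4, mul_add, add_assoc]
  clear hj
  induction j with
  | zero => exact ⟨X, Lowering.refl _ X, hX, rfl, rfl⟩
  | succ j ih =>
    obtain ⟨Y, h1, h2, h3, h4⟩ := ih (by omega)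
    obtain ⟨Z, h5, h6, h7, h8⟩ := h2.exists_lowering_one hp M (by omega)
    exact ⟨Z, h1.trans h5, h6, h7.trans h3, by omega⟩

end

/-! ### Young diagrams and the abacus -/

open Welter

section
variable (X : Finset ℕ)

theorem coin_lt_coin {i j : Fin X.card} : coin X i < coin X j ↔ j < i := by
  unfold coin
  rw [(X.orderEmbOfFin rfl).lt_iff_lt, Fin.rev_lt_rev]

theorem coin_mem (i : Fin X.card) : coin X i ∈ X := orderEmbOfFin_mem _ _ _

theorem coin_injective : Function.Injective (coin X) := by
  intro i j h
  rcases lt_trichotomy i j with hij | hij | hij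
  · exact absurd ((coin_lt_coin X).mpr hij) (by omega)
  · exact hij
  · exact absurd ((coin_lt_coin X).mpr hij) (by omega)

theorem image_coin : univ.image (coin X) = X := by
  refine eq_of_subset_of_card_le (fun x hx => ?_) ?_
  · obtain ⟨i, -, rfl⟩ := mem_image.mp hx
    exact coin_mem X i
  · rw [card_image_of_injective _ (coin_injective X), card_univ, Fintype.card_fin]

theorem card_filter_lt_coin (i : Fin X.card) : #{y ∈ range (coin X i) | y ∈ X} = X.card - 1 - i := by
  have : {y ∈ range (coin X i) | y ∈ X} = (Ioi i).image (coin X) := by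
    ext y
    simp only [mem_filter, mem_range, mem_image, mem_Ioi]
    constructor
    · rintro ⟨h1, h2⟩
      rw [← image_coin X] at h2
      obtain ⟨j, -, rfl⟩ := mem_image.mp h2
      exact ⟨j, (coin_lt_coin X).mp h1, rfl⟩
    · rintro ⟨j, hj, rfl⟩
      exact ⟨(coin_lt_coin X).mpr hj, coin_mem X j⟩
  rw [this, card_image_of_injective _ (coin_injective X), Fin.card_Ioi]

theorem part_eq_count (i : Fin X.card) : part X i = Nat.count (· ∉ X) (coin X i) := by
  rw [Nat.count_eq_card_filter_range, part, ← card_filter_lt_coin X i]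
  have := card_filter_add_card_filter_not (s := range (coin X i)) (fun y => y ∈ X)
  rw [card_range] at this
  omega

theorem mem_diagram {a j : ℕ} :
    (a, j) ∈ (diagram X).cells ↔ ∃ h : a < X.card, j < part X ⟨a, h⟩ := by
  simp only [diagram, mem_biUnion, mem_univ, true_and, mem_image, mem_range, Prod.mk.injEq]
  constructor
  · rintro ⟨i, k, hk, rfl, rfl⟩
    exact ⟨i.2, hk⟩
  · rintro ⟨h, hj⟩
    exact ⟨⟨a, h⟩, j, hj, rfl, rfl⟩

theorem card_filter_cells (P : ℕ × ℕ → Prop) [DecidablePred P] :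
    #{c ∈ (diagram X).cells | P c} =
      ∑ i : Fin X.card, #{j ∈ range (part X i) | P ((i : ℕ), j)} := by
  have e : {c ∈ (diagram X).cells | P c} = univ.biUnion fun i : Fin X.card =>
      ({j ∈ range (part X i) | P ((i : ℕ), j)}).image fun j => ((i : ℕ), j) := by
    ext ⟨a, j⟩
    simp only [mem_filter, mem_diagram, mem_biUnion, mem_univ, true_and, mem_image, mem_range,
      Prod.mk.injEq]
    constructor
    · rintro ⟨⟨h, hj⟩, hP⟩
      exact ⟨⟨a, h⟩, j, ⟨hj, hP⟩, rfl, rfl⟩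
    · rintro ⟨i, k, ⟨hk, hP⟩, rfl, rfl⟩
      exact ⟨⟨i.2, hk⟩, hP⟩
  rw [e, card_biUnion]
  · refine sum_congr rfl fun i _ => card_image_of_injective _ fun j k h => ?_
    exact (Prod.mk.inj h).2
  · intro i _ k _ hik
    rw [Function.onFun, disjoint_left]
    rintro c hc hc'
    obtain ⟨j, -, rfl⟩ := mem_image.mp hc
    obtain ⟨j', -, h⟩ := mem_image.mp hc'
    exact hik (Fin.ext (Prod.mk.inj h).1.symm)

theorem count_lt_count {y x : ℕ} (hy : y ∉ X) :
    Nat.count (· ∉ X) y < Nat.count (· ∉ X) x ↔ y < x := by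
  refine ⟨fun h => ?_, Nat.count_strict_mono hy⟩
  by_contra hn
  have := Nat.count_monotone (· ∉ X) (not_lt.mp hn)
  omega

theorem image_count (x : ℕ) :
    ({y ∈ range x | y ∉ X}).image (Nat.count (· ∉ X)) = range (Nat.count (· ∉ X) x) := by
  refine eq_of_subset_of_card_le (fun j hj => ?_) ?_
  · obtain ⟨y, hy, rfl⟩ := mem_image.mp hj
    simp only [mem_filter, mem_range] at hy ⊢
    exact (count_lt_count X hy.2).mpr hy.1
  · rw [card_image_of_injOn, card_range, Nat.count_eq_card_filter_range]
    intro y hy z hz h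
    simp only [coe_filter, Set.mem_ofPred_eq] at hy hz
    exact Nat.count_injective hy.2 hz.2 h

/-- The cells in the row of the hook match the gaps from `y` up to the bead, and those below match
the beads in between; together they fill the interval. -/
theorem card_hook (i : Fin X.card) {y : ℕ} (hy : y ∉ X) (hyi : y < coin X i) :
    (hook (diagram X) ((i : ℕ), Nat.count (· ∉ X) y)).card = coin X i - y := by
  have e : hook (diagram X) ((i : ℕ), Nat.count (· ∉ X) y) =
      ({z ∈ Ico y (coin X i) | z ∉ X}).image (fun z => ((i : ℕ), Nat.count (· ∉ X) z)) ∪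
      ({k | i < k ∧ y < coin X k} : Finset (Fin X.card)).image
        (fun k : Fin X.card => ((k : ℕ), Nat.count (· ∉ X) y)) := by
    ext ⟨a, j⟩
    simp only [hook, mem_filter, mem_diagram, mem_union, mem_image, mem_Ico, mem_univ, true_and,
      Prod.mk.injEq]
    constructor
    · rintro ⟨⟨h, hj⟩, h'⟩
      by_cases hai : a = i
      · subst hai
        rw [part_eq_count, ← mem_range, ← image_count] at hj
        obtain ⟨z, hz, rfl⟩ := mem_image.mp hj
        simp only [mem_filter, mem_range] at hz
        refine Or.inl ⟨z, ⟨⟨?_, hz.1⟩, hz.2⟩, rfl, rfl⟩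
        by_contra hn
        have := (count_lt_count X hz.2).mpr (not_le.mp hn)
        omega
      · have h1 : (i : ℕ) < a := by omega
        have h2 : j = Nat.count (· ∉ X) y := by omega
        subst h2
        rw [part_eq_count, count_lt_count X hy] at hj
        exact Or.inr ⟨⟨a, h⟩, ⟨h1, hj⟩, rfl, rfl⟩
    · rintro (⟨z, ⟨⟨h1, h2⟩, h3⟩, rfl, rfl⟩ | ⟨k, ⟨h1, h2⟩, rfl, rfl⟩)
      · refine ⟨⟨i.2, ?_⟩, Or.inr ⟨rfl, Nat.count_monotone _ h1⟩⟩
        rw [part_eq_count]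
        exact (count_lt_count X h3).mpr h2
      · refine ⟨⟨k.2, ?_⟩, Or.inl ⟨h1.le, rfl⟩⟩
        rw [part_eq_count]
        exact (count_lt_count X hy).mpr h2
  have e2 : ({k | i < k ∧ y < coin X k} : Finset (Fin X.card)).image (coin X) =
      {z ∈ Ico y (coin X i) | z ∈ X} := by
    ext z
    simp only [mem_image, mem_filter, mem_univ, true_and, mem_Ico]
    constructor
    · rintro ⟨k, ⟨h1, h2⟩, rfl⟩
      exact ⟨⟨h2.le, (coin_lt_coin X).mpr h1⟩, coin_mem X k⟩
    · rintro ⟨⟨h1, h2⟩, h3⟩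
      rw [← image_coin X] at h3
      obtain ⟨k, -, rfl⟩ := mem_image.mp h3
      refine ⟨k, ⟨(coin_lt_coin X).mp h2, lt_of_le_of_ne h1 ?_⟩, rfl⟩
      rintro rfl
      exact hy (coin_mem X k)
  rw [e, card_union_of_disjoint, card_image_of_injOn, card_image_of_injective,
    ← card_image_of_injective _ (coin_injective X), e2, add_comm, card_filter_add_card_filter_not,
    Nat.card_Ico]
  · intro k l h
    exact Fin.ext (Prod.mk.inj h).1
  · intro z hz w hw h
    simp only [coe_filter, Set.mem_ofPred_eq] at hz hw
    exact Nat.count_injective hz.2 hw.2 (Prod.mk.inj h).2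
  · rw [disjoint_left]
    rintro c hc hc'
    obtain ⟨z, -, rfl⟩ := mem_image.mp hc
    obtain ⟨k, hk, h⟩ := mem_image.mp hc'
    rw [mem_filter] at hk
    have := (Prod.mk.inj h).1
    have := Fin.lt_def.mp hk.2.1
    omega

theorem card_hook_dvd (q : ℕ) :
    #{c ∈ (diagram X).cells | q ∣ (hook (diagram X) c).card} = weight q X := by
  have e : weight q X =
      ∑ i : Fin X.card, #{y ∈ range (coin X i) | y ∉ X ∧ q ∣ coin X i - y} := by
    unfold weight
    conv_lhs => rw [← image_coin X, sum_image (fun i _ j _ h => coin_injective X h)]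
    rw [image_coin]
  rw [card_filter_cells, e]
  refine sum_congr rfl fun i _ => ?_
  symm
  apply card_bij (fun y _ => Nat.count (· ∉ X) y)
  · intro y hy
    simp only [mem_filter, mem_range] at hy ⊢
    rw [card_hook X i hy.2.1 hy.1, part_eq_count, count_lt_count X hy.2.1]
    exact ⟨hy.1, hy.2.2⟩
  · intro y hy z hz h
    simp only [mem_filter] at hy hz
    exact Nat.count_injective hy.2.1 hz.2.1 h
  · intro j hj
    rw [mem_filter, part_eq_count, ← image_count] at hj
    obtain ⟨hj1, hj2⟩ := hj
    obtain ⟨y, hy, rfl⟩ := mem_image.mp hj1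
    simp only [mem_filter, mem_range] at hy
    rw [card_hook X i hy.2 hy.1] at hj2
    exact ⟨y, by simpa using ⟨hy.1, hy.2, hj2⟩, rfl⟩

theorem size_eq_weight : size X = weight 1 X := by
  rw [← card_hook_dvd]
  simp [size, YoungDiagram.card]

theorem hookCount_eq_weight (p L : ℕ) : hookCount p X L = weight (p ^ L) X := card_hook_dvd X _

theorem core_eq_qcore (p : ℕ) : core p X = qcore p X := by
  simp only [core, qcore, component, runner, pow_one]

theorem tower_eq_weight {p : ℕ} (hp : 0 < p) (N : ℕ) :
    tower p X N = weight (p ^ N) (qcore (p ^ (N + 1)) X) := by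
  rw [weight_eq_sum (pow_pos hp N), tower]
  refine sum_congr rfl fun R hR => ?_
  rw [size_eq_weight, core_eq_qcore, pow_succ, runner_qcore_mul hp (mem_range.mp hR)]
  rfl

/-- By `weight_eq_add`, hook count and layer differ by a multiple of `p`. -/
theorem hookDigit_eq_layer_mod {p : ℕ} (hp : 0 < p) (q L : ℕ) :
    hookDigit p X (q + L) = layer p (p ^ q) L X % p := by
  rw [hookDigit, hookCount_eq_weight, weight_eq_add hp (pow_pos hp _), Nat.add_mul_mod_self_left,
    layer, pow_add, pow_succ, mul_assoc]

end

/-! ### Moves and Sprague–Grundy numbers -/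

section
variable {p m k : ℕ}

/-- The total displacement has order exactly `M` and each single one has order at least `M`; if all
had order above `M`, so would the total. -/
theorem isMove_of_map (hp : 2 ≤ p) {X Y : Position m} {M j : ℕ} (hj : ¬ p ∣ j) {g : ℕ → ℕ}
    (himg : X.1.image g = Y.1) (hg : ∀ x ∈ X.1, g x ≤ x ∧ p ^ M ∣ x - g x)
    (hw : weight 1 Y.1 + p ^ M * j = weight 1 X.1) (hk : #{x ∈ X.1 | x ≠ g x} < k) :
    IsMove p k X Y := by
  have hp0 : 0 < p := by omega
  let x : Fin m → ℕ := X.1.orderEmbOfFin X.2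
  have hxmem : ∀ i, x i ∈ X.1 := fun i => orderEmbOfFin_mem _ _ _
  have hxinj : Function.Injective x := (X.1.orderEmbOfFin X.2).injective
  have hx : univ.image x = X.1 := by
    refine eq_of_subset_of_card_le (fun a ha => ?_) ?_
    · obtain ⟨i, -, rfl⟩ := mem_image.mp ha
      exact hxmem i
    · rw [card_image_of_injective _ hxinj, card_univ, Fintype.card_fin, X.2]
  have hy : univ.image (g ∘ x) = Y.1 := by rw [← image_image, hx, himg]
  have hsum : ∑ i, ((x i : ℤ) - ((g ∘ x) i : ℤ)) = (p : ℤ) ^ M * j := by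
    have h1 := sum_eq_of_image_eq X x hx
    have h2 := sum_eq_of_image_eq Y (g ∘ x) hy
    rw [sum_eq_weight, X.2] at h1
    rw [sum_eq_weight, Y.2] at h2
    rw [sum_sub_distrib]
    have h3 : ∑ i, x i = ∑ i, (g ∘ x) i + p ^ M * j := by omega
    have h4 : ∑ i, (x i : ℤ) = ∑ i, ((g ∘ x) i : ℤ) + (p : ℤ) ^ M * j := by exact_mod_cast h3
    rw [h4]
    ring
  have hdvd : ∀ i, (p : ℤ) ^ M ∣ (x i : ℤ) - ((g ∘ x) i : ℤ) := by
    intro i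
    have h1 := hg (x i) (hxmem i)
    rw [Function.comp_apply, ← Nat.cast_sub h1.1]
    exact_mod_cast h1.2
  have hndvd : ¬ (p : ℤ) ^ (M + 1) ∣ (p : ℤ) ^ M * j := by
    intro h
    have h1 : p ^ (M + 1) ∣ p ^ M * j := by exact_mod_cast h
    rw [pow_succ] at h1
    exact hj (Nat.dvd_of_mul_dvd_mul_left (pow_pos hp0 M) h1)
  refine ⟨x, g ∘ x, hx, hy, ⟨?_, ?_⟩, fun i => (hg _ (hxmem i)).1, ?_⟩
  · rw [hammingDist_pos]
    intro h
    rw [← h] at hsum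
    simp only [sub_self, sum_const_zero] at hsum
    exact hndvd (hsum ▸ dvd_zero _)
  · refine lt_of_le_of_lt ?_ hk
    rw [hammingDist, ← card_image_of_injective _ hxinj]
    refine card_le_card fun a ha => ?_
    obtain ⟨i, hi, rfl⟩ := mem_image.mp ha
    exact mem_filter.mpr ⟨hxmem i, (mem_filter.mp hi).2⟩
  · rw [hsum]
    have h1 : emultiplicity (p : ℤ) ((p : ℤ) ^ M * j) = M :=
      emultiplicity_eq_coe.mpr ⟨Dvd.intro _ rfl, hndvd⟩
    rw [h1]
    refine le_antisymm (le_iInf fun i => le_emultiplicity_of_pow_dvd (hdvd i)) ?_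
    by_contra hlt
    rw [not_le, ← ENat.add_one_le_iff (ENat.natCast_ne_top M)] at hlt
    refine hndvd (hsum ▸ dvd_sum fun i _ => ?_)
    refine pow_dvd_of_le_emultiplicity (le_trans ?_ (hlt.trans (iInf_le _ i)))
    push_cast
    exact le_rfl

theorem isDescendant_of_dom (hp : 2 ≤ p) (hk : 2 ≤ k) {X Y : Position m} (h : Dom Y.1 X.1) :
    (game p m k).IsDescendant X Y := by
  have key : ∀ Z : Finset ℕ, Relation.ReflTransGen BoxRemoval X.1 Z →
      ∀ hZ : Z.card = m, (game p m k).IsDescendant X ⟨Z, hZ⟩ := by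
    intro Z hZ
    induction hZ with
    | refl => exact fun _ => Relation.ReflTransGen.refl
    | @tail W Z _ hWZ ih =>
      intro hZ
      obtain ⟨g, h1, h2, h3, h4⟩ := hWZ.exists_map
      have hW : W.card = m := by rw [← hZ, ← h2, card_image_of_injOn h1]
      refine (ih hW).tail ?_
      -- A single coin moves by one: the order is `0`, and one changed coin is allowed since `k ≥
      -- 2`.
      exact isMove_of_map hp (M := 0) (j := 1) (X := ⟨W, hW⟩) (Y := ⟨Z, hZ⟩)
        (by simp; omega) h2 (fun x hx => ⟨h3 x hx, by simp⟩) (by simpa using hWZ.weight)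
        (by simp only; omega)
  exact key Y.1 h.reflTransGen Y.2

theorem IsMove.weight_lt {X Y : Position m} (h : IsMove p k X Y) : weight 1 Y.1 < weight 1 X.1 := by
  obtain ⟨x, y, hx, hy, ⟨hd, -⟩, hle, -⟩ := h
  have h1 := sum_eq_of_image_eq X x hx
  have h2 := sum_eq_of_image_eq Y y hy
  rw [sum_eq_weight, X.2] at h1
  rw [sum_eq_weight, Y.2] at h2
  obtain ⟨i, hi⟩ := Function.ne_iff.mp (hammingDist_pos.mp hd)
  have := sum_lt_sum (fun j (_ : j ∈ univ) => hle j)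
    ⟨i, mem_univ i, lt_of_le_of_ne (hle i) (Ne.symm hi)⟩
  omega

theorem sg_le_weight (X : Position m) : (game p m k).sg X ≤ weight 1 X.1 := by
  induction hn : weight 1 X.1 using Nat.strong_induction_on generalizing X with
  | _ n ih =>
    rw [ImpartialGame.sg_eq]
    refine Nat.sInf_le fun Y hY => ?_
    have h1 : weight 1 Y.1 < weight 1 X.1 := IsMove.weight_lt hY
    have := ih _ (hn ▸ h1) Y rfl
    omega

theorem IsDescendant.weight_le {X Y : Position m} (h : (game p m k).IsDescendant X Y) :
    weight 1 Y.1 ≤ weight 1 X.1 := by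
  induction h with
  | refl => exact le_rfl
  | tail _ h ih => exact (IsMove.weight_lt h).le.trans ih

/-- The Sprague-Grundy number of a full position in the game with the largest `p`-index. -/
theorem Full.sg_eq_weight (hp : 2 ≤ p) {X : Position m} (hX : Full p X.1) :
    (game p m (m + 1)).sg X = weight 1 X.1 := by
  induction hn : weight 1 X.1 using Nat.strong_induction_on generalizing X with
  | _ n ih =>
    refine le_antisymm (hn ▸ sg_le_weight X) ?_
    by_contra hlt
    rw [not_le] at hlt
    set s := (game p m (m + 1)).sg X with hs
    -- If the value `s` were below the size, a full option of size `s` would exist, and it has value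
    -- `s` by induction. The order of `n - s` tells which runners to use.
    obtain ⟨M, j, hj, hMj⟩ := Nat.exists_eq_pow_mul_and_not_dvd (n := n - s) (by omega) p (by omega)
    obtain ⟨Y, ⟨g, hg1, hg2, hg3⟩, hY2, hY3⟩ := hX.exists_lowering hp M (j := j) (by omega)
    have hYc : Y.card = m := by rw [← hg2, card_image_of_injOn hg1, X.2]
    -- Index `m + 1` lets all coins move at once.
    have hmove : (game p m (m + 1)).Edge X ⟨Y, hYc⟩ :=
      isMove_of_map hp hj (Y := ⟨Y, hYc⟩) hg2 hg3 hY3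
        (Nat.lt_succ_of_le ((card_filter_le _ _).trans X.2.le))
    have h1 : weight 1 Y = s := by omega
    have h2 := ih s (by omega) (X := ⟨Y, hYc⟩) hY2 h1
    have h3 : s ∈ {n : ℕ | ∀ Y, (game p m (m + 1)).Edge X Y → (game p m (m + 1)).sg Y ≠ n} := by
      rw [hs, ImpartialGame.sg_eq]
      refine Nat.sInf_mem ⟨weight 1 X.1, fun Z hZ => ?_⟩
      have h4 : weight 1 Z.1 < weight 1 X.1 := IsMove.weight_lt hZ
      have := sg_le_weight (p := p) (k := m + 1) Z
      omega
    exact h3 _ hmove h2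

theorem sg_eq_zero_of_index_one (X : Position m) : (game p m 1).sg X = 0 := by
  rw [ImpartialGame.sg_eq]
  refine Nat.le_zero.mp (Nat.sInf_le fun Y hY => ?_)
  obtain ⟨x, y, -, -, ⟨h1, h2⟩, -⟩ := hY
  omega

theorem sum_pred_mul_pow (hp : 0 < p) (n : ℕ) : ∑ L ∈ range n, (p - 1) * p ^ L = p ^ n - 1 := by
  induction n with
  | zero => simp
  | succ n ih =>
    have h1 : p ^ n ≤ p * p ^ n := Nat.le_mul_of_pos_left _ hp
    have h2 : 0 < p ^ n := pow_pos hp n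
    rw [sum_range_succ, ih, pow_succ', Nat.sub_mul, one_mul]
    omega

theorem ofDigitSeq_hookDigit (hp : 2 ≤ p) (X : Finset ℕ) (N : ℕ) :
    ofDigitSeq p (fun L => if L ≤ N then p - 1 else hookDigit p X L) = p ^ (N + 1) - 1 +
      p ^ (N + 1) * ∑ L ∈ range (size X), layer p (p ^ (N + 1)) L X % p * p ^ L := by
  -- From index `size X` on, `p ^ L` exceeds every hook length and the digits vanish.
  rw [ofDigitSeq, finsum_eq_sum_of_support_subset (s := range (N + 1 + size X)), sum_range_add]
  · rw [← sum_pred_mul_pow (by omega), mul_sum]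
    congr 1
    · refine sum_congr rfl fun L hL => ?_
      rw [mem_range] at hL
      rw [if_pos (by omega)]
    · refine sum_congr rfl fun L _ => ?_
      rw [if_neg (by omega), hookDigit_eq_layer_mod X (by omega), pow_add]
      ring
  · intro L hL
    rw [coe_range, Set.mem_Iio]
    by_contra hn
    apply hL
    simp only
    rw [if_neg (by omega), hookDigit_eq_zero p hp X L (by omega), zero_mul]

end

end Abacus

/-! ### The proposition -/

theorem proposition3p3 (p : ℕ) (hp : 2 ≤ p) (m k : ℕ) (hk : Welter.IsSaturation p m k)
    (X : Welter.Position m) (N : ℕ) (hN : p + 1 ≤ Welter.tower p X.1 N) :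
    IsGreatest (Welter.fullValues p m k X) (Welter.msg p m k X) ∧
    Welter.ofDigitSeq p (fun L => if L ≤ N then p - 1 else Welter.hookDigit p X.1 L) ≤
      Welter.msg p m k X := by
  obtain ⟨hk0, hsg⟩ := hk
  rw [Abacus.tower_eq_weight _ (by omega)] at hN
  obtain ⟨Y, hY1, hY2, hY3⟩ := Abacus.exists_full hp hN
  let Y' : Welter.Position m := ⟨Y, hY1.1.trans X.2⟩
  have hsgY : (Welter.game p m k).sg Y' = Abacus.weight 1 Y := by
    rw [hsg]
    exact Abacus.Full.sg_eq_weight hp (X := Y') hY2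
  -- For `k = 1` there are no moves and all values are zero, whereas `Y` has at least `p ^ (N + 1) -
  -- 1 > 0` boxes.
  have hk2 : 2 ≤ k := by
    by_contra hlt
    obtain rfl : k = 1 := by omega
    rw [Abacus.sg_eq_zero_of_index_one] at hsgY
    have h1 := hY3 0
    have h2 : p ≤ p ^ (N + 1) := Nat.le_self_pow (by omega) p
    omega
  have hmem : Abacus.weight 1 Y ∈ Welter.fullValues p m k X :=
    ⟨Y', Abacus.isDescendant_of_dom hp hk2 hY1, hsgY.trans (Abacus.size_eq_weight Y).symm,
      hsgY.symm⟩
  have hbdd : BddAbove (Welter.fullValues p m k X) := by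
    refine ⟨Abacus.weight 1 X.1, ?_⟩
    rintro n ⟨Z, hZ1, -, rfl⟩
    exact (Abacus.sg_le_weight Z).trans (Abacus.IsDescendant.weight_le hZ1)
  refine ⟨⟨Nat.sSup_mem ⟨_, hmem⟩ hbdd, fun n hn => le_csSup hbdd hn⟩, ?_⟩
  rw [Abacus.ofDigitSeq_hookDigit hp]
  exact (hY3 _).trans (le_csSup hbdd hmem)
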